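/- Let $n\ge 1$ and let $F$ be a $C^1$ real function on the space of real symmetric $n\times n$ matrices which is uniformly elliptic: for some $\mu>0$, $\mu I\le (F_{ij}(M))\le \mu^{-1}I$ for all symmetric $M$, where $(F_{ij}(M))$ is the symmetric matrix with $DF(M)[H]=\sum_{i,j}F_{ij}(M)H_{ij}$ for symmetric $H$. Let $d\in\mathbb R$, $d\neq 2$, and let $u$ be continuous on $\mathbb R^n\setminus\{0\}$, homogeneous of degree $d$ (that is, $u(tx)=t^d u(x)$ for $t>0$, $x\ne0$), and a viscosity solution of $F(D^2u)=0$ in $\mathbb R^n\setminus\{0\}$. Then: 1. $u$ is $C^\infty$ on $\mathbb R^n\setminus\{0\}$ and $\sum_{i,j=1}^n F_{ij}(0)\,D_{ij}u(x)=0$ for all $x\neq0$. 2. If $-(n-2)<d<0$ or $d$ is not an integer, then $u\equiv0$ on $\mathbb R^n\setminus\{0\}$. 3. There is an invertible matrix $A$ with $AA^{T}=(F_{ij}(0))$ such that $v(y)=u(Ay)$ is harmonic on $\mathbb R^n\setminus\{0\}$ and the following hold. (a) If $n\ge2$ and $d=k\ge0$ is an integer, then $v$ coincides on $\mathbb R^n\setminus\{0\}$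 with a homogeneous harmonic polynomial of degree $k$. (b) If $n\ge2$ and $d=-(n-2)-k$ with $k\ge0$ an integer, then $v(y)=|y|^{2d+n-2}p(y)$ for $y\neq0$, where $p$ is a homogeneous harmonic polynomial of degree $k=2-n-d$ (so $v$ is the Kelvin transform of $p$). (c) If $u$ is moreover defined and continuous at $0$ and is a viscosity solution of $F(D^2u)=0$ in all of $\mathbb R^n$ (any $n\ge1$), then either $u\equiv0$ on $\mathbb R^n$, or $d=k\ge0$ is an integer and $v$ coincides on $\mathbb R^n$ with a homogeneous harmonic polynomial of degree $k$. (The zero polynomial counts as homogeneous of every degree.) -/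

import Mathlib

open Set Filter Topology
open scoped Matrix ContDiff

-- Entrywise sup norm on matrices; all norms are equivalent here, so `C¹` does not depend on it.
attribute [local instance] Matrix.normedAddCommGroup Matrix.normedSpace

noncomputable section

namespace FullyNonlinear

/-- The space of real symmetric `n × n` matrices. -/
def SymMatrix (n : ℕ) : Submodule ℝ (Matrix (Fin n) (Fin n) ℝ) where
  carrier := {A | A.IsSymm}
  add_mem' := fun ha hb => Matrix.IsSymm.add ha hb
  zero_mem' := Matrix.isSymm_zero
  smul_mem' := fun c _ ha => Matrix.IsSymm.smul ha c

/-- The symmetric matrix `(E_ij + E_ji) / 2`. -/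
def symUnit {n : ℕ} (i j : Fin n) : SymMatrix n :=
  ⟨(1 / 2 : ℝ) • (Matrix.single i j 1 + Matrix.single j i 1), by
    change ((1 / 2 : ℝ) • (Matrix.single i j (1 : ℝ) + Matrix.single j i 1))ᵀ = _
    rw [Matrix.transpose_smul, Matrix.transpose_add, Matrix.transpose_single,
      Matrix.transpose_single, add_comm]⟩

/-- The symmetric matrix `(F_ij(M))` of first derivatives of `F` at `M`. It is the gradient for the
trace inner product: `DF(M)[H] = ∑ i j, F_ij(M) * H_ij` for every symmetric `H`. -/
def gradMatrix {n : ℕ} (F : SymMatrix n → ℝ) (M : SymMatrix n) : Matrix (Fin n) (Fin n) ℝ :=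
  Matrix.of fun i j => fderiv ℝ F M (symUnit i j)

/-- Uniform ellipticity: `μ I ≤ (F_ij(M)) ≤ μ⁻¹ I` for every symmetric `M`. -/
def UniformlyElliptic {n : ℕ} (μ : ℝ) (F : SymMatrix n → ℝ) : Prop :=
  ∀ M : SymMatrix n,
    (gradMatrix F M - μ • (1 : Matrix (Fin n) (Fin n) ℝ)).PosSemidef ∧
      (μ⁻¹ • (1 : Matrix (Fin n) (Fin n) ℝ) - gradMatrix F M).PosSemidef

/-- The Hessian matrix `D²φ(x)` with entries `D_ij φ(x)`. -/
def hessian {n : ℕ} (φ : EuclideanSpace ℝ (Fin n) → ℝ) (x : EuclideanSpace ℝ (Fin n)) :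
    Matrix (Fin n) (Fin n) ℝ :=
  Matrix.of fun i j =>
    fderiv ℝ (fderiv ℝ φ) x (EuclideanSpace.single i 1) (EuclideanSpace.single j 1)

theorem hessian_mem_symMatrix {n : ℕ} {φ : EuclideanSpace ℝ (Fin n) → ℝ}
    {x : EuclideanSpace ℝ (Fin n)} (hφ : ContDiffAt ℝ 2 φ x) : hessian φ x ∈ SymMatrix n := by
  have h : IsSymmSndFDerivAt ℝ φ x := hφ.isSymmSndFDerivAt (by simp)
  change (hessian φ x)ᵀ = hessian φ x
  ext i j
  exact h _ _

/-- The Hessian of a function that is `C²` near `x`, as a symmetric matrix. -/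
def symHessian {n : ℕ} (φ : EuclideanSpace ℝ (Fin n) → ℝ) (x : EuclideanSpace ℝ (Fin n))
    (hφ : ContDiffAt ℝ 2 φ x) : SymMatrix n :=
  ⟨hessian φ x, hessian_mem_symMatrix hφ⟩

/-- Viscosity subsolution of `F(D²u) = 0` in the open set `Ω`: whenever a `C²` function `φ` touches
`u` from above at a point `x₀` of `Ω`, `F(D²φ(x₀)) ≥ 0`. -/
def IsViscositySubsolution {n : ℕ} (F : SymMatrix n → ℝ) (Ω : Set (EuclideanSpace ℝ (Fin n)))
    (u : EuclideanSpace ℝ (Fin n) → ℝ) : Prop :=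
  ∀ x₀ ∈ Ω, ∀ φ : EuclideanSpace ℝ (Fin n) → ℝ, ∀ hφ : ContDiffAt ℝ 2 φ x₀,
    φ x₀ = u x₀ → (∀ᶠ x in 𝓝 x₀, u x ≤ φ x) → 0 ≤ F (symHessian φ x₀ hφ)

/-- Viscosity supersolution of `F(D²u) = 0` in the open set `Ω`: whenever a `C²` function `φ`
touches `u` from below at a point `x₀` of `Ω`, `F(D²φ(x₀)) ≤ 0`. -/
def IsViscositySupersolution {n : ℕ} (F : SymMatrix n → ℝ) (Ω : Set (EuclideanSpace ℝ (Fin n)))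
    (u : EuclideanSpace ℝ (Fin n) → ℝ) : Prop :=
  ∀ x₀ ∈ Ω, ∀ φ : EuclideanSpace ℝ (Fin n) → ℝ, ∀ hφ : ContDiffAt ℝ 2 φ x₀,
    φ x₀ = u x₀ → (∀ᶠ x in 𝓝 x₀, φ x ≤ u x) → F (symHessian φ x₀ hφ) ≤ 0

/-- Viscosity solution of `F(D²u) = 0` in the open set `Ω`. -/
def IsViscositySolution {n : ℕ} (F : SymMatrix n → ℝ) (Ω : Set (EuclideanSpace ℝ (Fin n)))
    (u : EuclideanSpace ℝ (Fin n) → ℝ) : Prop :=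
  ContinuousOn u Ω ∧ IsViscositySubsolution F Ω u ∧ IsViscositySupersolution F Ω u

/-- `u` is (positively) homogeneous of real degree `d` on `ℝⁿ ∖ {0}`. -/
def HomogeneousOfDegree {n : ℕ} (d : ℝ) (u : EuclideanSpace ℝ (Fin n) → ℝ) : Prop :=
  ∀ t : ℝ, 0 < t → ∀ x : EuclideanSpace ℝ (Fin n), x ≠ 0 → u (t • x) = t ^ d * u x

/-- Homogeneous harmonic polynomials of degree `k` in `n` variables (including `0`). -/
def IsHomogeneousHarmonic {n : ℕ} (k : ℕ) (p : MvPolynomial (Fin n) ℝ) : Prop :=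
  p.IsHomogeneous k ∧ ∑ i, MvPolynomial.pderiv i (MvPolynomial.pderiv i p) = 0

/-- The value of a polynomial at a point of `ℝⁿ`. -/
def evalAt {n : ℕ} (p : MvPolynomial (Fin n) ℝ) (y : EuclideanSpace ℝ (Fin n)) : ℝ :=
  MvPolynomial.eval (fun i => y i) p

end FullyNonlinear

end

noncomputable section

namespace FullyNonlinear

/-! ### Calculus of the Hessian -/

/-! The equation linearizes by scaling. If `φ` touches `u` from above at `x₀`, then `t^d φ(·/t)`
touches `u` from above at `t x₀`, with Hessian `t^(d-2) D²φ(x₀)`. Since `d ≠ 2`, the factor takes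
every value `s > 0`, so `F(s D²φ(x₀)) ≥ 0` along a whole ray (`IsViscositySubsolution.ray_nonneg`).
Taking `φ = c|x|^d`, with `c` the maximum of `u` on the unit sphere, and letting `s → 0` gives `F(0)
≥ 0`; the reflected argument gives `F(0) = 0` (`apply_zero_eq_zero`). Dividing by `s` then yields
`DF(0)[D²φ(x₀)] ≥ 0`. The same holds for `-u`, so `u` solves a linear constant-coefficient equation
in the viscosity sense. Ellipticity lets one write `(F_ij(0)) = A Aᵀ` with `A` invertible, and `v =
u ∘ A` is viscosity harmonic (`LinearSubsolution.comp_linear`).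

Regularity of `v` comes from harmonic polynomials. They are uniformly dense in the continuous
functions on a sphere, and comparison carries the approximation into the ball. Each equals its
average against a radial bump, and this passes to the uniform limit, so `v` is locally its own
mollification (`exists_contDiff_eq_of_harmonic_near`). A logarithmic barrier gives the same result
on a punctured ball when `v` is bounded and `n ≥ 2` (`exists_contDiff_extension`).

The classification depends on the degree. For `d ≥ 0` the singularity is removable, and a
homogeneous function smooth at the origin is a Taylor polynomial or zero
(`homogeneous_classification`). For `d ≤ -(n-2)` the Kelvin transform reduces to the previous case.
For `d(d+n-2) < 0` comparison with `|x|^d` forces `v = 0`. The vanishing in dimension one for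
noninteger `d` is computed directly. -/

theorem differentiableAt_fderiv {n : ℕ} {f : EuclideanSpace ℝ (Fin n) → ℝ}
    {x : EuclideanSpace ℝ (Fin n)} (hf : ContDiffAt ℝ 2 f x) :
    DifferentiableAt ℝ (fderiv ℝ f) x :=
  (hf.fderiv_right (m := 1) (by norm_num)).differentiableAt (by norm_num)

theorem eventually_differentiableAt {n : ℕ} {f : EuclideanSpace ℝ (Fin n) → ℝ}
    {x : EuclideanSpace ℝ (Fin n)} (hf : ContDiffAt ℝ 2 f x) :
    ∀ᶠ y in 𝓝 x, DifferentiableAt ℝ f y :=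
  (hf.eventually (by simp)).mono fun _ hy => hy.differentiableAt (by norm_num)

theorem hessian_of_hasFDerivAt {n : ℕ} {f : EuclideanSpace ℝ (Fin n) → ℝ}
    {x : EuclideanSpace ℝ (Fin n)}
    {f' : EuclideanSpace ℝ (Fin n) → EuclideanSpace ℝ (Fin n) →L[ℝ] ℝ}
    {f'' : EuclideanSpace ℝ (Fin n) →L[ℝ] EuclideanSpace ℝ (Fin n) →L[ℝ] ℝ}
    (h : ∀ᶠ y in 𝓝 x, HasFDerivAt f (f' y) y) (h' : HasFDerivAt f' f'' x) (i j : Fin n) :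
    hessian f x i j = f'' (EuclideanSpace.single i 1) (EuclideanSpace.single j 1) := by
  have : fderiv ℝ f =ᶠ[𝓝 x] f' := h.mono fun y hy => hy.fderiv
  simp only [hessian, Matrix.of_apply, this.fderiv_eq, h'.fderiv]

theorem hessian_congr {n : ℕ} {f g : EuclideanSpace ℝ (Fin n) → ℝ}
    {x : EuclideanSpace ℝ (Fin n)} (h : f =ᶠ[𝓝 x] g) : hessian f x = hessian g x := by
  simp only [hessian, h.fderiv.fderiv_eq]

theorem hessian_add {n : ℕ} {f g : EuclideanSpace ℝ (Fin n) → ℝ}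
    {x : EuclideanSpace ℝ (Fin n)} (hf : ContDiffAt ℝ 2 f x) (hg : ContDiffAt ℝ 2 g x) :
    hessian (fun y => f y + g y) x = hessian f x + hessian g x := by
  ext i j
  rw [hessian_of_hasFDerivAt (f' := fun y => fderiv ℝ f y + fderiv ℝ g y)
    (by
      filter_upwards [eventually_differentiableAt hf, eventually_differentiableAt hg] with y h1 h2
      exact h1.hasFDerivAt.add h2.hasFDerivAt)
    ((differentiableAt_fderiv hf).hasFDerivAt.add (differentiableAt_fderiv hg).hasFDerivAt)]
  rfl

theorem hessian_const_mul {n : ℕ} {f : EuclideanSpace ℝ (Fin n) → ℝ}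
    {x : EuclideanSpace ℝ (Fin n)} (c : ℝ) (hf : ContDiffAt ℝ 2 f x) :
    hessian (fun y => c * f y) x = c • hessian f x := by
  ext i j
  rw [hessian_of_hasFDerivAt (f' := fun y => c • fderiv ℝ f y)
    (by
      filter_upwards [eventually_differentiableAt hf] with y h1
      exact h1.hasFDerivAt.const_mul c)
    ((differentiableAt_fderiv hf).hasFDerivAt.const_smul c)]
  rfl

theorem hessian_const {n : ℕ} (c : ℝ) (x : EuclideanSpace ℝ (Fin n)) :
    hessian (fun _ => c) x = 0 := by
  ext i j
  rw [hessian_of_hasFDerivAt (f' := fun _ => 0) (Eventually.of_forall fun y =>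
    hasFDerivAt_const c y) (hasFDerivAt_const _ x)]
  rfl

theorem hessian_comp_linear {n : ℕ} {f : EuclideanSpace ℝ (Fin n) → ℝ}
    (B : EuclideanSpace ℝ (Fin n) →L[ℝ] EuclideanSpace ℝ (Fin n))
    {x : EuclideanSpace ℝ (Fin n)} (hf : ContDiffAt ℝ 2 f (B x)) (i j : Fin n) :
    hessian (fun y => f (B y)) x i j =
      fderiv ℝ (fderiv ℝ f) (B x) (B (EuclideanSpace.single i 1))
        (B (EuclideanSpace.single j 1)) := by
  have h2 : HasFDerivAt (fun y => fderiv ℝ f (B y)) _ x :=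
    (differentiableAt_fderiv hf).hasFDerivAt.comp x B.hasFDerivAt
  have h3 : HasFDerivAt (fun L : EuclideanSpace ℝ (Fin n) →L[ℝ] ℝ => L.comp B)
      ((ContinuousLinearMap.compL ℝ _ _ ℝ).flip B) (fderiv ℝ f (B x)) :=
    ((ContinuousLinearMap.compL ℝ _ _ ℝ).flip B).hasFDerivAt
  have h4 : HasFDerivAt (fun y => (fderiv ℝ f (B y)).comp B) _ x :=
    HasFDerivAt.comp (f := fun y => fderiv ℝ f (B y)) x h3 h2
  rw [hessian_of_hasFDerivAt (f' := fun y => (fderiv ℝ f (B y)).comp B)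
    (by
      filter_upwards [B.continuous.continuousAt.eventually (eventually_differentiableAt hf)]
        with y h1
      exact h1.hasFDerivAt.comp y B.hasFDerivAt)
    h4]
  rfl

theorem fderiv_fderiv_apply_eq_sum {n : ℕ} (f : EuclideanSpace ℝ (Fin n) → ℝ)
    (x v w : EuclideanSpace ℝ (Fin n)) :
    fderiv ℝ (fderiv ℝ f) x v w = ∑ i, ∑ j, v i * w j * hessian f x i j := by
  have hv : ∀ v : EuclideanSpace ℝ (Fin n), v = ∑ i, v i • EuclideanSpace.single i (1 : ℝ) := by
    intro v
    have := (EuclideanSpace.basisFun (Fin n) ℝ).sum_repr v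
    simpa using this.symm
  conv_lhs => rw [hv v, hv w]
  simp only [map_sum, map_smul, sum_apply, smul_apply,
    smul_eq_mul, hessian, Matrix.of_apply, Finset.mul_sum]
  rw [Finset.sum_comm]
  exact Finset.sum_congr rfl fun i _ => Finset.sum_congr rfl fun j _ => by ring

/-- The Laplacian as the trace of the Hessian. -/
def lap {n : ℕ} (f : EuclideanSpace ℝ (Fin n) → ℝ) (x : EuclideanSpace ℝ (Fin n)) : ℝ :=
  ∑ i, hessian f x i i

theorem lap_congr {n : ℕ} {f g : EuclideanSpace ℝ (Fin n) → ℝ}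
    {x : EuclideanSpace ℝ (Fin n)} (h : f =ᶠ[𝓝 x] g) : lap f x = lap g x := by
  simp only [lap, hessian_congr h]

theorem lap_add {n : ℕ} {f g : EuclideanSpace ℝ (Fin n) → ℝ}
    {x : EuclideanSpace ℝ (Fin n)} (hf : ContDiffAt ℝ 2 f x) (hg : ContDiffAt ℝ 2 g x) :
    lap (fun y => f y + g y) x = lap f x + lap g x := by
  simp [lap, hessian_add hf hg, Finset.sum_add_distrib]

theorem lap_const_mul {n : ℕ} {f : EuclideanSpace ℝ (Fin n) → ℝ}
    {x : EuclideanSpace ℝ (Fin n)} (c : ℝ) (hf : ContDiffAt ℝ 2 f x) :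
    lap (fun y => c * f y) x = c * lap f x := by
  simp [lap, hessian_const_mul c hf, Finset.mul_sum]

theorem lap_const {n : ℕ} (c : ℝ) (x : EuclideanSpace ℝ (Fin n)) :
    lap (fun _ => c) x = 0 := by
  simp [lap, hessian_const]

theorem lap_neg {n : ℕ} {f : EuclideanSpace ℝ (Fin n) → ℝ}
    {x : EuclideanSpace ℝ (Fin n)} (hf : ContDiffAt ℝ 2 f x) :
    lap (fun y => -f y) x = -lap f x := by
  simpa using lap_const_mul (-1) hf

theorem laplacian_eq_lap {n : ℕ} (f : EuclideanSpace ℝ (Fin n) → ℝ)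
    (x : EuclideanSpace ℝ (Fin n)) : Laplacian.laplacian f x = lap f x := by
  rw [InnerProductSpace.laplacian_eq_iteratedFDeriv_orthonormalBasis f
    (EuclideanSpace.basisFun (Fin n) ℝ)]
  simp [lap, hessian, iteratedFDeriv_two_apply]

theorem lap_mul {n : ℕ} {f g : EuclideanSpace ℝ (Fin n) → ℝ}
    {x : EuclideanSpace ℝ (Fin n)} (hf : ContDiffAt ℝ 2 f x) (hg : ContDiffAt ℝ 2 g x) :
    lap (fun y => f y * g y) x = f x * lap g x + g x * lap f x +
      2 * ∑ i, fderiv ℝ f x (EuclideanSpace.single i 1) *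
        fderiv ℝ g x (EuclideanSpace.single i 1) := by
  have hf1 := (hf.differentiableAt (by norm_num)).hasFDerivAt
  have hg1 := (hg.differentiableAt (by norm_num)).hasFDerivAt
  have hf2 := (differentiableAt_fderiv hf).hasFDerivAt
  have hg2 := (differentiableAt_fderiv hg).hasFDerivAt
  have key : ∀ i, hessian (fun y => f y * g y) x i i = f x * hessian g x i i +
      g x * hessian f x i i + 2 * (fderiv ℝ f x (EuclideanSpace.single i 1) *
        fderiv ℝ g x (EuclideanSpace.single i 1)) := by
    intro i
    rw [hessian_of_hasFDerivAt (f' := fun y => f y • fderiv ℝ g y + g y • fderiv ℝ f y)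
      (by
        filter_upwards [eventually_differentiableAt hf, eventually_differentiableAt hg]
          with y h1 h2
        exact h1.hasFDerivAt.mul h2.hasFDerivAt)
      ((hf1.smul hg2).add (hg1.smul hf2))]
    simp [hessian]
    ring
  simp only [lap, key, Finset.sum_add_distrib, Finset.mul_sum]

/-- Second order necessary condition at a local minimum. -/
theorem lap_nonneg_of_isLocalMin {n : ℕ} {f : EuclideanSpace ℝ (Fin n) → ℝ}
    {x : EuclideanSpace ℝ (Fin n)} (hf : ContDiffAt ℝ 2 f x) (hx : IsLocalMin f x) :
    0 ≤ lap f x := by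
  refine Finset.sum_nonneg fun i _ => ?_
  by_contra! hneg
  set e : EuclideanSpace ℝ (Fin n) := EuclideanSpace.single i 1
  set g : ℝ → ℝ := fun t => f (x + t • e) with hg
  have hl : ∀ t : ℝ, HasDerivAt (fun t : ℝ => x + t • e) e t := fun t => by
    simpa using ((hasDerivAt_id t).smul_const e).const_add x
  have hcont : Tendsto (fun t : ℝ => x + t • e) (𝓝 0) (𝓝 x) := by
    simpa using (hl 0).continuousAt.tendsto
  have hg1 : ∀ᶠ t in 𝓝 (0 : ℝ), HasDerivAt g (fderiv ℝ f (x + t • e) e) t := by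
    filter_upwards [hcont.eventually (eventually_differentiableAt hf)] with t ht
    exact ht.hasFDerivAt.comp_hasDerivAt t (hl t)
  have hg2 : HasDerivAt (fun t : ℝ => fderiv ℝ f (x + t • e) e) (hessian f x i i) 0 := by
    have h1 : HasFDerivAt (fderiv ℝ f) (fderiv ℝ (fderiv ℝ f) x) (x + (0 : ℝ) • e) := by
      simpa using (differentiableAt_fderiv hf).hasFDerivAt
    have h2 := h1.comp_hasDerivAt (0 : ℝ) (hl 0)
    exact ((ContinuousLinearMap.apply ℝ ℝ e).hasFDerivAt).comp_hasDerivAt (0 : ℝ) h2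
  have hd : deriv g =ᶠ[𝓝 0] fun t => fderiv ℝ f (x + t • e) e := hg1.mono fun t ht => ht.deriv
  have hdd : deriv (deriv g) 0 = hessian f x i i := by rw [hd.deriv_eq, hg2.deriv]
  have hmin : IsLocalMin g 0 := by
    have : ∀ᶠ t in 𝓝 (0 : ℝ), f x ≤ f (x + t • e) := hcont.eventually hx
    simpa [IsLocalMin, IsMinFilter, hg] using this
  -- A negative second derivative would make the minimum also a local maximum. Then `g` is locally
  -- constant and its second derivative is zero, a contradiction.
  have hmax : IsLocalMax g 0 := isLocalMax_of_deriv_deriv_neg (by rw [hdd]; exact hneg)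
    hmin.deriv_eq_zero hg1.self_of_nhds.continuousAt
  have hconst : g =ᶠ[𝓝 0] fun _ => g 0 := by
    filter_upwards [hmin, hmax] with t h1 h2
    exact le_antisymm h2 h1
  have : deriv (deriv g) 0 = 0 := by
    rw [hconst.deriv.deriv_eq]
    simp
  linarith

/-! ### Radial functions -/

/-- Radial functions are written through `|x|²` rather than `|x|`, so that the chain rule applies at
the origin as well. -/
theorem hasFDerivAt_radial {n : ℕ} {g : ℝ → ℝ} {g' : ℝ} {x : EuclideanSpace ℝ (Fin n)}
    (h : HasDerivAt g g' (‖x‖ ^ 2)) :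
    HasFDerivAt (fun y : EuclideanSpace ℝ (Fin n) => g (‖y‖ ^ 2)) ((2 * g') • innerSL ℝ x) x := by
  have := h.comp_hasFDerivAt x (hasStrictFDerivAt_norm_sq x).hasFDerivAt
  convert! this using 1
  ext v
  simp
  ring

theorem lap_radial {n : ℕ} {g g' : ℝ → ℝ} {g'' : ℝ} {x : EuclideanSpace ℝ (Fin n)}
    (h : ∀ᶠ t in 𝓝 (‖x‖ ^ 2), HasDerivAt g (g' t) t) (h' : HasDerivAt g' g'' (‖x‖ ^ 2)) :
    lap (fun y : EuclideanSpace ℝ (Fin n) => g (‖y‖ ^ 2)) x =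
      4 * ‖x‖ ^ 2 * g'' + 2 * n * g' (‖x‖ ^ 2) := by
  have hc : ContinuousAt (fun y : EuclideanSpace ℝ (Fin n) => ‖y‖ ^ 2) x := by fun_prop
  let l : EuclideanSpace ℝ (Fin n) →L[ℝ] EuclideanSpace ℝ (Fin n) →L[ℝ] ℝ := innerSL ℝ
  have hl : ∀ a b, l a b = inner ℝ a b := fun _ _ => rfl
  have key : ∀ i, hessian (fun y : EuclideanSpace ℝ (Fin n) => g (‖y‖ ^ 2)) x i i =
      4 * g'' * x i ^ 2 + 2 * g' (‖x‖ ^ 2) := by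
    intro i
    rw [hessian_of_hasFDerivAt (f' := fun y => (2 * g' (‖y‖ ^ 2)) • l y)
      (by
        filter_upwards [hc.eventually h] with y hy
        exact hasFDerivAt_radial hy)
      (((hasFDerivAt_radial h').const_mul 2).smul l.hasFDerivAt)]
    simp only [add_apply, smul_apply, ContinuousLinearMap.smulRight_apply, innerSL_apply_apply, hl,
      EuclideanSpace.inner_single_right, smul_eq_mul]
    simp
    ring
  simp only [lap, key, Finset.sum_add_distrib, ← Finset.mul_sum, ← EuclideanSpace.real_norm_sq_eq]
  simp
  ring

/-! ### Polynomials as functions on Euclidean space -/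

theorem contDiff_evalAt {n : ℕ} {m : WithTop ℕ∞} (p : MvPolynomial (Fin n) ℝ) :
    ContDiff ℝ m (evalAt p) := by
  induction p using MvPolynomial.induction_on with
  | C a =>
    have : evalAt (n := n) (MvPolynomial.C a) = fun _ => a := by ext; simp [evalAt]
    rw [this]
    exact contDiff_const
  | add p q hp hq =>
    have : evalAt (p + q) = fun y => evalAt p y + evalAt q y := by ext; simp [evalAt]
    rw [this]
    exact hp.add hq
  | mul_X p i hp =>
    have hi : ContDiff ℝ m fun y : EuclideanSpace ℝ (Fin n) => y i :=
      (EuclideanSpace.proj i : EuclideanSpace ℝ (Fin n) →L[ℝ] ℝ).contDiff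
    have : evalAt (p * MvPolynomial.X i) = fun y => evalAt p y * y i := by ext; simp [evalAt]
    rw [this]
    exact hp.mul hi

theorem continuous_evalAt {n : ℕ} (p : MvPolynomial (Fin n) ℝ) : Continuous (evalAt p) :=
  (contDiff_evalAt (m := 0) p).continuous

theorem hasFDerivAt_evalAt {n : ℕ} (p : MvPolynomial (Fin n) ℝ) (y : EuclideanSpace ℝ (Fin n)) :
    HasFDerivAt (evalAt p) (∑ i, evalAt (MvPolynomial.pderiv i p) y •
      (EuclideanSpace.proj i : EuclideanSpace ℝ (Fin n) →L[ℝ] ℝ)) y := by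
  induction p using MvPolynomial.induction_on with
  | C a =>
    have : evalAt (n := n) (MvPolynomial.C a) = fun _ => a := by ext; simp [evalAt]
    simpa [this, evalAt] using hasFDerivAt_const a y
  | add p q hp hq =>
    have : evalAt (p + q) = fun y => evalAt p y + evalAt q y := by ext; simp [evalAt]
    rw [this]
    convert! hp.add hq using 1
    simp [evalAt, add_smul, Finset.sum_add_distrib]
  | mul_X p j hp =>
    have : evalAt (p * MvPolynomial.X j) = fun y => evalAt p y * y j := by ext; simp [evalAt]
    have hj : HasFDerivAt (fun y : EuclideanSpace ℝ (Fin n) => y j)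
      ((EuclideanSpace.proj j : EuclideanSpace ℝ (Fin n) →L[ℝ] ℝ)) y :=
      (EuclideanSpace.proj j : EuclideanSpace ℝ (Fin n) →L[ℝ] ℝ).hasFDerivAt
    rw [this]
    convert! hp.mul hj using 1
    ext v
    simp [evalAt, MvPolynomial.pderiv_X, Pi.single_apply, add_mul, Finset.sum_add_distrib,
      Finset.mul_sum, apply_ite]
    exact Finset.sum_congr rfl fun i _ => by ring

theorem hessian_evalAt {n : ℕ} (p : MvPolynomial (Fin n) ℝ) (x : EuclideanSpace ℝ (Fin n))
    (i j : Fin n) :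
    hessian (evalAt p) x i j = evalAt (MvPolynomial.pderiv i (MvPolynomial.pderiv j p)) x := by
  have h : HasFDerivAt (fun y => ∑ k, evalAt (MvPolynomial.pderiv k p) y •
      (EuclideanSpace.proj k : EuclideanSpace ℝ (Fin n) →L[ℝ] ℝ))
      (∑ k, ContinuousLinearMap.smulRight (∑ l, evalAt (MvPolynomial.pderiv l
        (MvPolynomial.pderiv k p)) x • (EuclideanSpace.proj l : EuclideanSpace ℝ (Fin n) →L[ℝ] ℝ))
        ((EuclideanSpace.proj k : EuclideanSpace ℝ (Fin n) →L[ℝ] ℝ))) x :=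
    HasFDerivAt.fun_sum fun k _ =>
      (hasFDerivAt_evalAt (MvPolynomial.pderiv k p) x).smul_const
        (EuclideanSpace.proj k : EuclideanSpace ℝ (Fin n) →L[ℝ] ℝ)
  rw [hessian_of_hasFDerivAt (Eventually.of_forall (hasFDerivAt_evalAt p)) h]
  simp

/-- The Laplacian on polynomials. -/
def polyLap {n : ℕ} : MvPolynomial (Fin n) ℝ →ₗ[ℝ] MvPolynomial (Fin n) ℝ :=
  ∑ i, (MvPolynomial.pderiv i).toLinearMap ∘ₗ (MvPolynomial.pderiv i).toLinearMap

theorem polyLap_apply {n : ℕ} (p : MvPolynomial (Fin n) ℝ) :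
    polyLap p = ∑ i, MvPolynomial.pderiv i (MvPolynomial.pderiv i p) := by
  simp [polyLap]

theorem lap_evalAt {n : ℕ} (p : MvPolynomial (Fin n) ℝ) (x : EuclideanSpace ℝ (Fin n)) :
    lap (evalAt p) x = evalAt (polyLap p) x := by
  simp [lap, hessian_evalAt, polyLap_apply, evalAt]

theorem totalDegree_pderiv_le {n : ℕ} (p : MvPolynomial (Fin n) ℝ) (i : Fin n) :
    (MvPolynomial.pderiv i p).totalDegree ≤ p.totalDegree - 1 := by
  conv_lhs => rw [p.as_sum, map_sum]
  refine MvPolynomial.totalDegree_finsetSum_le fun s hs => ?_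
  have hle : s.degree ≤ p.totalDegree := MvPolynomial.le_totalDegree hs
  rw [MvPolynomial.pderiv_monomial]
  rcases Nat.eq_zero_or_pos (s i) with h0 | h0
  · simp [h0]
  refine (MvPolynomial.totalDegree_monomial_le _ _).trans ?_
  have h1 : Finsupp.single i 1 ≤ s := by simpa using Nat.succ_le_of_lt h0
  have h2 : (s - Finsupp.single i 1).degree + 1 = s.degree := by
    conv_rhs => rw [← tsub_add_cancel_of_le h1]
    rw [map_add, Finsupp.degree_single]
  change (s - Finsupp.single i 1).degree ≤ _
  omega

theorem totalDegree_polyLap_le {n : ℕ} (p : MvPolynomial (Fin n) ℝ) :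
    (polyLap p).totalDegree ≤ p.totalDegree - 2 := by
  rw [polyLap_apply]
  refine MvPolynomial.totalDegree_finsetSum_le fun i _ => ?_
  have h1 := totalDegree_pderiv_le (MvPolynomial.pderiv i p) i
  have h2 := totalDegree_pderiv_le p i
  omega

/-- The polynomial `R² - |x - c|²`. -/
def ballPoly {n : ℕ} (c : EuclideanSpace ℝ (Fin n)) (R : ℝ) : MvPolynomial (Fin n) ℝ :=
  MvPolynomial.C (R ^ 2) - ∑ i, (MvPolynomial.X i - MvPolynomial.C (c i)) ^ 2

theorem evalAt_ballPoly {n : ℕ} (c : EuclideanSpace ℝ (Fin n)) (R : ℝ)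
    (x : EuclideanSpace ℝ (Fin n)) : evalAt (ballPoly c R) x = R ^ 2 - ‖x - c‖ ^ 2 := by
  simp [evalAt, ballPoly, EuclideanSpace.real_norm_sq_eq]

theorem polyLap_ballPoly {n : ℕ} (c : EuclideanSpace ℝ (Fin n)) (R : ℝ) :
    polyLap (ballPoly c R) = MvPolynomial.C (-2 * (n : ℝ)) := by
  have h : ∀ i, MvPolynomial.pderiv i (MvPolynomial.pderiv i (ballPoly c R)) =
      MvPolynomial.C (-2) := by
    intro i
    have : MvPolynomial.pderiv i (ballPoly c R) =
        MvPolynomial.C (-2) * (MvPolynomial.X i - MvPolynomial.C (c i)) := by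
      simp only [ballPoly, map_sub, MvPolynomial.pderiv_C, map_sum, MvPolynomial.pderiv_pow,
        MvPolynomial.pderiv_X, Pi.single_apply]
      simp [show (MvPolynomial.C 2 : MvPolynomial (Fin n) ℝ) = 2 from map_ofNat _ 2]
    rw [this]
    simp
  simp [polyLap_apply, h]
  ring

theorem totalDegree_ballPoly_le {n : ℕ} (c : EuclideanSpace ℝ (Fin n)) (R : ℝ) :
    (ballPoly c R).totalDegree ≤ 2 := by
  refine (MvPolynomial.totalDegree_sub _ _).trans
    (max_le (by rw [MvPolynomial.totalDegree_C]; omega) ?_)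
  refine MvPolynomial.totalDegree_finsetSum_le fun i _ => ?_
  refine (MvPolynomial.totalDegree_pow _ _).trans ?_
  have : (MvPolynomial.X i - MvPolynomial.C (c i) : MvPolynomial (Fin n) ℝ).totalDegree ≤ 1 :=
    (MvPolynomial.totalDegree_sub _ _).trans (max_le (by simp) (by simp))
  omega

/-- A ball contains a box, and a polynomial is determined by its values on a product of infinite
sets. -/
theorem eq_zero_of_evalAt_ball {n : ℕ} {p : MvPolynomial (Fin n) ℝ}
    {c : EuclideanSpace ℝ (Fin n)} {R : ℝ} (hR : 0 < R)
    (h : ∀ x ∈ Metric.ball c R, evalAt p x = 0) : p = 0 := by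
  have hopen : IsOpen (WithLp.toLp 2 ⁻¹' Metric.ball c R : Set (Fin n → ℝ)) :=
    Metric.isOpen_ball.preimage (PiLp.continuous_toLp 2 _)
  obtain ⟨r, hr, hsub⟩ := Metric.isOpen_iff.1 hopen (WithLp.ofLp c) (by simpa using hR)
  refine MvPolynomial.funext_set (fun i => Metric.ball (c i) r)
    (fun i => by rw [Real.ball_eq_Ioo]; exact Ioo_infinite (by linarith)) fun x hx => ?_
  have hx' : x ∈ Metric.ball (WithLp.ofLp c) r := by
    rw [ball_pi _ hr]; exact hx
  simpa [evalAt] using h _ (hsub hx')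

/-! ### Viscosity subharmonic functions and comparison -/

/-- Viscosity subsolutions of the Laplace equation. -/
def ViscositySubharmonic {n : ℕ} (U : Set (EuclideanSpace ℝ (Fin n)))
    (v : EuclideanSpace ℝ (Fin n) → ℝ) : Prop :=
  ∀ x₀ ∈ U, ∀ φ : EuclideanSpace ℝ (Fin n) → ℝ, ContDiffAt ℝ 2 φ x₀ →
    φ x₀ = v x₀ → (∀ᶠ x in 𝓝 x₀, v x ≤ φ x) → 0 ≤ lap φ x₀

theorem ViscositySubharmonic.mono {n : ℕ} {U V : Set (EuclideanSpace ℝ (Fin n))}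
    {v : EuclideanSpace ℝ (Fin n) → ℝ} (h : ViscositySubharmonic V v) (hUV : U ⊆ V) :
    ViscositySubharmonic U v := fun x hx => h x (hUV hx)

theorem viscositySubharmonic_of_lap_nonneg {n : ℕ} {U : Set (EuclideanSpace ℝ (Fin n))}
    {v : EuclideanSpace ℝ (Fin n) → ℝ} (hv : ∀ x ∈ U, ContDiffAt ℝ 2 v x)
    (hl : ∀ x ∈ U, 0 ≤ lap v x) : ViscositySubharmonic U v := by
  intro x hx φ hφ he hle
  have hmin : IsLocalMin (fun y => φ y + -v y) x := by
    filter_upwards [hle] with y hy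
    linarith
  have := lap_nonneg_of_isLocalMin (hφ.add (hv x hx).neg) hmin
  rw [lap_add hφ (hv x hx).neg, lap_neg (hv x hx)] at this
  linarith [hl x hx]

/-- If `v - φ` were positive somewhere, `hK` would force it to attain its maximum over `U`; there a
vertical shift of `φ` touches `v` from above, against `lap φ < 0`. Condition `hK` stands in for
boundary values and covers a singular point too. -/
theorem ViscositySubharmonic.le_of_strict {n : ℕ} {U : Set (EuclideanSpace ℝ (Fin n))}
    {v φ : EuclideanSpace ℝ (Fin n) → ℝ} (hU : IsOpen U) (hv : ContinuousOn v U)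
    (hsub : ViscositySubharmonic U v) (hφ : ∀ x ∈ U, ContDiffAt ℝ 2 φ x)
    (hneg : ∀ x ∈ U, lap φ x < 0)
    (hK : ∀ η > 0, ∃ K ⊆ U, IsCompact K ∧ ∀ x ∈ U, x ∉ K → v x - φ x < η) :
    ∀ x ∈ U, v x ≤ φ x := by
  intro x hx
  by_contra! hlt
  obtain ⟨K, hKU, hKc, hKlt⟩ := hK (v x - φ x) (by linarith)
  have hxK : x ∈ K := by
    by_contra h
    exact lt_irrefl _ (hKlt x hx h)
  have hc : ContinuousOn (fun y => v y - φ y) K :=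
    (hv.mono hKU).sub fun y hy => (hφ y (hKU hy)).continuousAt.continuousWithinAt
  obtain ⟨x₀, hx₀, hmax⟩ := hKc.exists_isMaxOn ⟨x, hxK⟩ hc
  have hx₀U := hKU hx₀
  have htouch : ∀ᶠ y in 𝓝 x₀, v y ≤ φ y + (v x₀ - φ x₀) := by
    filter_upwards [hU.mem_nhds hx₀U] with y hy
    by_cases hyK : y ∈ K
    · have : v y - φ y ≤ v x₀ - φ x₀ := hmax hyK
      linarith
    · have h1 := hKlt y hy hyK
      have h2 : v x - φ x ≤ v x₀ - φ x₀ := hmax hxK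
      linarith
  have h := hsub x₀ hx₀U (fun y => φ y + (v x₀ - φ x₀)) ((hφ x₀ hx₀U).add contDiffAt_const)
    (by ring) htouch
  rw [lap_add (hφ x₀ hx₀U) contDiffAt_const, lap_const] at h
  linarith [hneg x₀ hx₀U]

/-- Comparison on `U` with a superharmonic barrier `b` which controls `D \ U`. -/
theorem ViscositySubharmonic.le_of_barrier {n : ℕ} {U D : Set (EuclideanSpace ℝ (Fin n))}
    {v h b : EuclideanSpace ℝ (Fin n) → ℝ} {M : ℝ} (hU : IsOpen U) (hUD : U ⊆ D)
    (hv : ContinuousOn v D) (hsub : ViscositySubharmonic U v) (hvM : ∀ x ∈ D, v x ≤ M)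
    (hh : ContDiff ℝ 2 h) (hharm : ∀ x, lap h x = 0) (hhM : ∀ x ∈ D, -M ≤ h x)
    (hb : ∀ x ∈ U, ContDiffAt ℝ 2 b x) (hbneg : ∀ x ∈ U, lap b x < 0)
    (hbc : ContinuousOn b D) (hb0 : ∀ x ∈ D, 0 ≤ b x)
    (hbK : ∀ N : ℝ, ∃ K ⊆ D, IsCompact K ∧ ∀ x ∈ D, x ∉ K → N < b x)
    (hbd : ∀ x ∈ D, x ∉ U → v x ≤ h x) : ∀ x ∈ U, v x ≤ h x := by
  -- Adding `δ * b` makes the harmonic `h` strictly superharmonic; the claim follows as `δ → 0`.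
  have key : ∀ δ > 0, ∀ x ∈ U, v x ≤ h x + δ * b x := by
    intro δ hδ
    refine hsub.le_of_strict hU (hv.mono hUD)
      (fun x hx => hh.contDiffAt.add (contDiffAt_const.mul (hb x hx)))
      (fun x hx => ?_) fun η hη => ?_
    · rw [lap_add hh.contDiffAt (contDiffAt_const.mul (hb x hx)), lap_const_mul δ (hb x hx),
        hharm, zero_add]
      exact mul_neg_of_pos_of_neg hδ (hbneg x hx)
    -- Off this `K`, `δ * b > 2 * M ≥ v - h`, so the difference is negative there.
    · obtain ⟨K, hKD, hKc, hKb⟩ := hbK (2 * M / δ)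
      have hc : ContinuousOn (fun y => v y - (h y + δ * b y)) K :=
        (hv.mono hKD).sub (hh.continuous.continuousOn.add
          (continuousOn_const.mul (hbc.mono hKD)))
      -- Intersecting with the superlevel set pushes the compact set into `U`: on `D \ U` one has `v
      -- ≤ h ≤ h + δ * b`, so no point of it reaches the level `η > 0`.
      refine ⟨K ∩ {x | η ≤ v x - (h x + δ * b x)}, fun x hx => ?_, ?_, fun x hx hxK => ?_⟩
      · by_contra hxU
        have h1 := hbd x (hKD hx.1) hxU
        have h2 := mul_nonneg hδ.le (hb0 x (hKD hx.1))
        have h3 : η ≤ v x - (h x + δ * b x) := hx.2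
        linarith
      · exact hKc.of_isClosed_subset
          (hc.preimage_isClosed_of_isClosed hKc.isClosed isClosed_Ici) inter_subset_left
      · by_contra! hle
        have hxK' : x ∉ K := fun h => hxK ⟨h, hle⟩
        have h1 := hKb x (hUD hx) hxK'
        rw [div_lt_iff₀ hδ] at h1
        linarith [hvM x (hUD hx), hhM x (hUD hx)]
  intro x hx
  have hlim : Tendsto (fun δ : ℝ => h x + δ * b x) (𝓝[>] 0) (𝓝 (h x + 0 * b x)) :=
    (by fun_prop : Continuous fun δ : ℝ => h x + δ * b x).continuousWithinAt
  rw [zero_mul, add_zero] at hlim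
  refine ge_of_tendsto hlim ?_
  filter_upwards [self_mem_nhdsWithin] with δ hδ
  exact key δ hδ x hx

/-- The barrier is `R² - |x - c|²`, with Laplacian `-2n`. The closed ball is compact, so no blow-up
of the barrier is needed. -/
theorem ViscositySubharmonic.le_on_ball {n : ℕ} (hn : 0 < n) {c : EuclideanSpace ℝ (Fin n)}
    {R : ℝ} {v h : EuclideanSpace ℝ (Fin n) → ℝ} (hv : ContinuousOn v (Metric.closedBall c R))
    (hsub : ViscositySubharmonic (Metric.ball c R) v) (hh : ContDiff ℝ 2 h)
    (hharm : ∀ x, lap h x = 0) (hbd : ∀ x ∈ Metric.sphere c R, v x ≤ h x) :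
    ∀ x ∈ Metric.ball c R, v x ≤ h x := by
  obtain ⟨M₁, hM₁⟩ := (isCompact_closedBall c R).exists_bound_of_continuousOn hv
  obtain ⟨M₂, hM₂⟩ := (isCompact_closedBall c R).exists_bound_of_continuousOn
    hh.continuous.continuousOn
  refine hsub.le_of_barrier (b := evalAt (ballPoly c R)) (M := max M₁ M₂) Metric.isOpen_ball
    Metric.ball_subset_closedBall hv
    (fun x hx => (le_abs_self _).trans ((hM₁ x hx).trans (le_max_left _ _))) hh hharm
    (fun x hx => (abs_le.1 ((hM₂ x hx).trans (le_max_right M₁ M₂))).1)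
    (fun x _ => (contDiff_evalAt _).contDiffAt) (fun x _ => ?_)
    (continuous_evalAt _).continuousOn (fun x hx => ?_)
    (fun N => ⟨_, subset_rfl, isCompact_closedBall c R, fun x h1 h2 => absurd h1 h2⟩)
    (fun x hx hx' => hbd x ?_)
  · rw [lap_evalAt, polyLap_ballPoly]
    have : (0 : ℝ) < n := by exact_mod_cast hn
    simpa [evalAt] using this
  · rw [evalAt_ballPoly]
    have h1 : ‖x - c‖ ≤ R := by simpa [dist_eq_norm] using hx
    nlinarith [norm_nonneg (x - c)]
  · simp only [Metric.mem_closedBall, Metric.mem_ball, not_lt, Metric.mem_sphere] at *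
    exact le_antisymm hx hx'

/-- The barrier is `-log |x|² + (1 - |x|²)`. The logarithm blows up at the puncture, so boundedness
of `v` suffices there; its Laplacian `(4 - 2n)/|x|²` is only nonpositive for `n ≥ 2`, and the
quadratic term makes the sum strictly superharmonic. -/
theorem ViscositySubharmonic.le_on_punctured_ball {n : ℕ} (hn : 2 ≤ n)
    {v h : EuclideanSpace ℝ (Fin n) → ℝ} {M : ℝ}
    (hv : ContinuousOn v (Metric.closedBall 0 1 \ {0}))
    (hvM : ∀ x ∈ Metric.closedBall (0 : EuclideanSpace ℝ (Fin n)) 1 \ {0}, v x ≤ M)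
    (hsub : ViscositySubharmonic (Metric.ball 0 1 \ {0}) v) (hh : ContDiff ℝ 2 h)
    (hharm : ∀ x, lap h x = 0) (hbd : ∀ x ∈ Metric.sphere 0 1, v x ≤ h x) :
    ∀ x ∈ Metric.ball 0 1 \ {0}, v x ≤ h x := by
  obtain ⟨M₂, hM₂⟩ := (isCompact_closedBall (0 : EuclideanSpace ℝ (Fin n)) 1
    ).exists_bound_of_continuousOn hh.continuous.continuousOn
  have hlog : ∀ x : EuclideanSpace ℝ (Fin n), x ≠ 0 →
      ContDiffAt ℝ 2 (fun x : EuclideanSpace ℝ (Fin n) => -Real.log (‖x‖ ^ 2)) x := fun x hx =>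
    ((contDiff_norm_sq ℝ).contDiffAt.log (by simpa using hx)).neg
  have hball : ∀ x ∈ Metric.closedBall (0 : EuclideanSpace ℝ (Fin n)) 1,
      0 ≤ evalAt (ballPoly 0 1) x := fun x hx => by
    rw [evalAt_ballPoly]
    have h1 : ‖x - 0‖ ≤ 1 := by simpa using hx
    nlinarith [norm_nonneg (x - 0)]
  refine hsub.le_of_barrier
    (b := fun x => -Real.log (‖x‖ ^ 2) + evalAt (ballPoly 0 1) x) (M := max M M₂)
    (Metric.isOpen_ball.sdiff isClosed_singleton)
    (sdiff_subset_sdiff_left Metric.ball_subset_closedBall) hv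
    (fun x hx => (hvM x hx).trans (le_max_left _ _)) hh hharm
    (fun x hx => (abs_le.1 ((hM₂ x hx.1).trans (le_max_right M M₂))).1)
    (fun x hx => (hlog x hx.2).add (contDiff_evalAt _).contDiffAt) (fun x hx => ?_)
    (fun x hx => ((hlog x hx.2).continuousAt.add
      (continuous_evalAt _).continuousAt).continuousWithinAt)
    (fun x hx => add_nonneg ?_ (hball x hx.1)) (fun N => ?_)
    (fun x hx hx' => hbd x ?_)
  · have hx0 : 0 < ‖x‖ ^ 2 := by
      have : 0 < ‖x‖ := norm_pos_iff.2 hx.2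
      positivity
    rw [lap_add (hlog x hx.2) (contDiff_evalAt _).contDiffAt, lap_evalAt, polyLap_ballPoly,
      lap_radial (g := fun t => -Real.log t) (g' := fun t => -t⁻¹) (g'' := ((‖x‖ ^ 2) ^ 2)⁻¹)
        ((lt_mem_nhds hx0).mono fun t ht => (Real.hasDerivAt_log ht.ne').neg)
        (by simpa using (hasDerivAt_inv hx0.ne').fun_neg)]
    have h2 : (2 : ℝ) ≤ n := by exact_mod_cast hn
    have h3 : 4 * ‖x‖ ^ 2 * ((‖x‖ ^ 2) ^ 2)⁻¹ + 2 * n * -(‖x‖ ^ 2)⁻¹ =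
        (4 - 2 * n) * (‖x‖ ^ 2)⁻¹ := by
      field_simp
      ring
    have h4 : (4 - 2 * (n : ℝ)) * (‖x‖ ^ 2)⁻¹ ≤ 0 :=
      mul_nonpos_of_nonpos_of_nonneg (by linarith) (by positivity)
    simp only [evalAt, MvPolynomial.eval_C]
    linarith
  · have h1 : ‖x‖ ≤ 1 := by simpa using hx.1
    have := Real.log_nonpos (sq_nonneg ‖x‖) (by nlinarith [norm_nonneg x])
    linarith
  -- Inside the removed ball `-log |x|² > 2(|N| + 1) > N`.
  · refine ⟨Metric.closedBall 0 1 \ Metric.ball 0 (Real.exp (-(|N| + 1))),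
      sdiff_subset_sdiff_right (by simp [Real.exp_pos]),
      (isCompact_closedBall _ _).diff Metric.isOpen_ball, fun x hx hxK => ?_⟩
    have hlt : ‖x‖ < Real.exp (-(|N| + 1)) := by
      by_contra hge
      exact hxK ⟨hx.1, by simpa using hge⟩
    have hx0 : 0 < ‖x‖ := norm_pos_iff.2 hx.2
    have h1 : Real.log ‖x‖ < -(|N| + 1) := (Real.log_lt_iff_lt_exp hx0).2 hlt
    have h2 : Real.log (‖x‖ ^ 2) = 2 * Real.log ‖x‖ := by simp [Real.log_pow]
    have h3 := hball x hx.1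
    have h4 := le_abs_self N
    have h5 := abs_nonneg N
    simp only [h2]
    linarith
  · simp only [Metric.mem_closedBall, Metric.mem_ball, Metric.mem_sphere,
      Set.mem_sdiff, mem_singleton_iff] at *
    by_contra hne
    exact hx' ⟨lt_of_le_of_ne hx.1 hne, hx.2⟩

/-! ### Approximation by harmonic polynomials. -/

theorem viscositySubharmonic_evalAt {n : ℕ} {p : MvPolynomial (Fin n) ℝ} (hp : polyLap p = 0)
    (U : Set (EuclideanSpace ℝ (Fin n))) : ViscositySubharmonic U (evalAt p) :=
  viscositySubharmonic_of_lap_nonneg (fun _ _ => (contDiff_evalAt p).contDiffAt) fun x _ => by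
    simp [lap_evalAt, hp, evalAt]

/-- A harmonic polynomial which vanishes on a sphere vanishes in the ball. -/
theorem evalAt_eq_zero_of_sphere {n : ℕ} (hn : 0 < n) {c : EuclideanSpace ℝ (Fin n)} {R : ℝ}
    {p : MvPolynomial (Fin n) ℝ} (hp : polyLap p = 0)
    (h : ∀ x ∈ Metric.sphere c R, evalAt p x = 0) :
    ∀ x ∈ Metric.ball c R, evalAt p x = 0 := by
  have key : ∀ q : MvPolynomial (Fin n) ℝ, polyLap q = 0 →
      (∀ x ∈ Metric.sphere c R, evalAt q x = 0) → ∀ x ∈ Metric.ball c R, evalAt q x ≤ 0 :=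
    fun q hq hs => (viscositySubharmonic_evalAt hq _).le_on_ball hn
      (continuous_evalAt q).continuousOn contDiff_const (fun x => lap_const 0 x)
      fun x hx => (hs x hx).le
  intro x hx
  have h1 := key p hp h x hx
  have h2 := key (-p) (by simp [hp]) (fun y hy => by
    have := h y hy
    simpa [evalAt] using this) x hx
  have h3 : evalAt (-p) x = -evalAt p x := by simp [evalAt]
  linarith

/-- Every polynomial agrees on a sphere with a harmonic polynomial. -/
theorem exists_harmonic_eq_on_sphere {n : ℕ} (hn : 0 < n) (c : EuclideanSpace ℝ (Fin n)) {R : ℝ}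
    (hR : 0 < R) (p : MvPolynomial (Fin n) ℝ) :
    ∃ q : MvPolynomial (Fin n) ℝ, polyLap q = 0 ∧
      ∀ x ∈ Metric.sphere c R, evalAt q x = evalAt p x := by
  set V := MvPolynomial.restrictTotalDegree (Fin n) ℝ p.totalDegree
  -- Subtracting a multiple `b * q` of `b = ballPoly c R` does not change values on the sphere, so
  -- it suffices to solve `Δ(b q) = Δp`. The map `q ↦ Δ(b q)` preserves the degree bound, since `b`
  -- raises the degree by at most two. It is injective by the maximum principle, hence surjective by
  -- finite dimension.
  let L : MvPolynomial (Fin n) ℝ →ₗ[ℝ] MvPolynomial (Fin n) ℝ :=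
    polyLap ∘ₗ LinearMap.mulLeft ℝ (ballPoly c R)
  have hLV : ∀ q ∈ V, L q ∈ V := by
    intro q hq
    rw [MvPolynomial.mem_restrictTotalDegree] at hq ⊢
    have h1 : (L q).totalDegree ≤ (ballPoly c R * q).totalDegree - 2 := totalDegree_polyLap_le _
    have h2 := MvPolynomial.totalDegree_mul (ballPoly c R) q
    have h3 := totalDegree_ballPoly_le c R
    omega
  have hinj : Function.Injective (L.restrict hLV) := by
    rw [← LinearMap.ker_eq_bot, LinearMap.ker_eq_bot']
    rintro ⟨q, hq⟩ h0
    have hL : polyLap (ballPoly c R * q) = 0 := congrArg Subtype.val h0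
    have hmul : ∀ x, evalAt (ballPoly c R * q) x = (R ^ 2 - ‖x - c‖ ^ 2) * evalAt q x := fun x => by
      rw [← evalAt_ballPoly]; simp [evalAt]
    have hz := evalAt_eq_zero_of_sphere hn (c := c) (R := R) hL fun x hx => by
      rw [hmul, ← dist_eq_norm, Metric.mem_sphere.1 hx, sub_self, zero_mul]
    refine Subtype.ext (eq_zero_of_evalAt_ball (c := c) hR fun x hx => ?_)
    have := hz x hx
    rw [hmul] at this
    have hlt : ‖x - c‖ < R := by simpa [dist_eq_norm] using hx
    have : R ^ 2 - ‖x - c‖ ^ 2 ≠ 0 := by nlinarith [norm_nonneg (x - c)]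
    simp_all
  have hsurj := LinearMap.surjective_of_injective hinj
  have hpV : polyLap p ∈ V := by
    rw [MvPolynomial.mem_restrictTotalDegree]
    exact (totalDegree_polyLap_le p).trans (Nat.sub_le _ _)
  obtain ⟨⟨q, hq⟩, hqp⟩ := hsurj ⟨polyLap p, hpV⟩
  have hqp' : polyLap (ballPoly c R * q) = polyLap p := congrArg Subtype.val hqp
  refine ⟨p - ballPoly c R * q, by rw [map_sub, hqp', sub_self], fun x hx => ?_⟩
  have h1 : evalAt (ballPoly c R) x = 0 := by
    rw [evalAt_ballPoly, ← dist_eq_norm, Metric.mem_sphere.1 hx, sub_self]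
  simp only [evalAt, map_sub, map_mul] at h1 ⊢
  rw [h1, zero_mul, sub_zero]

/-- Stone–Weierstrass for the subalgebra of `C(K, ℝ)` generated by the coordinate functions. -/
theorem exists_polynomial_near {n : ℕ} {K : Set (EuclideanSpace ℝ (Fin n))} (hK : IsCompact K)
    {v : EuclideanSpace ℝ (Fin n) → ℝ} (hv : ContinuousOn v K) {ε : ℝ} (hε : 0 < ε) :
    ∃ p : MvPolynomial (Fin n) ℝ, ∀ x ∈ K, |v x - evalAt p x| ≤ ε := by
  have : CompactSpace K := isCompact_iff_compactSpace.1 hK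
  let X : Fin n → C(K, ℝ) := fun i => ⟨fun x => x.1 i, by fun_prop⟩
  have hX : ∀ (p : MvPolynomial (Fin n) ℝ) (x : K), MvPolynomial.aeval X p x = evalAt p x := by
    intro p x
    induction p using MvPolynomial.induction_on with
    | C a => simp [evalAt, algebraMap_apply]
    | add p q hp hq => simp_all [evalAt]
    | mul_X p i hp => simp_all [evalAt, X]
  have hsep : (MvPolynomial.aeval (R := ℝ) X).range.SeparatesPoints := by
    intro x y hxy
    have : ∃ i, x.1 i ≠ y.1 i := by
      by_contra! h
      exact hxy (Subtype.ext (PiLp.ext h))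
    obtain ⟨i, hi⟩ := this
    exact ⟨X i, ⟨X i, ⟨MvPolynomial.X i, by simp⟩, rfl⟩, hi⟩
  obtain ⟨⟨g, p, hp⟩, hg⟩ :=
    ContinuousMap.exists_mem_subalgebra_near_continuous_of_separatesPoints _ hsep
      (K.domRestrict v) hv.domRestrict ε hε
  refine ⟨p, fun x hx => ?_⟩
  have h := (hg ⟨x, hx⟩).le
  rw [abs_sub_comm, ← hX p ⟨x, hx⟩]
  simpa [← hp] using h

theorem exists_harmonic_near_on_sphere {n : ℕ} (hn : 0 < n) {c : EuclideanSpace ℝ (Fin n)}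
    {R : ℝ} (hR : 0 < R) {v : EuclideanSpace ℝ (Fin n) → ℝ}
    (hv : ContinuousOn v (Metric.sphere c R)) {ε : ℝ} (hε : 0 < ε) :
    ∃ p : MvPolynomial (Fin n) ℝ, polyLap p = 0 ∧
      ∀ x ∈ Metric.sphere c R, |v x - evalAt p x| ≤ ε := by
  obtain ⟨p, hp⟩ := exists_polynomial_near (isCompact_sphere c R) hv hε
  obtain ⟨q, hq, hqp⟩ := exists_harmonic_eq_on_sphere hn c hR p
  exact ⟨q, hq, fun x hx => by rw [hqp x hx]; exact hp x hx⟩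

/-- The approximation on the sphere propagates inside by comparing `v` with `p + ε` and `-v` with
`-p + ε`. -/
theorem exists_harmonic_near_on_ball {n : ℕ} (hn : 0 < n) {c : EuclideanSpace ℝ (Fin n)}
    {R : ℝ} (hR : 0 < R) {v : EuclideanSpace ℝ (Fin n) → ℝ}
    (hv : ContinuousOn v (Metric.closedBall c R))
    (hsub : ViscositySubharmonic (Metric.ball c R) v)
    (hsup : ViscositySubharmonic (Metric.ball c R) fun x => -v x) {ε : ℝ} (hε : 0 < ε) :
    ∃ p : MvPolynomial (Fin n) ℝ, polyLap p = 0 ∧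
      ∀ x ∈ Metric.ball c R, |v x - evalAt p x| ≤ ε := by
  obtain ⟨p, hp, hpv⟩ := exists_harmonic_near_on_sphere hn hR
    (hv.mono Metric.sphere_subset_closedBall) hε
  have hP : ContDiff ℝ 2 (evalAt p) := contDiff_evalAt p
  have hl : ∀ x, lap (evalAt p) x = 0 := fun x => by simp [lap_evalAt, hp, evalAt]
  refine ⟨p, hp, fun x hx => ?_⟩
  have h1 := hsub.le_on_ball (h := fun x => evalAt p x + ε) hn hv (hP.add contDiff_const)
    (fun x => by rw [lap_add hP.contDiffAt contDiffAt_const, hl, lap_const, add_zero])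
    (fun x hx => by linarith [(abs_le.1 (hpv x hx)).2]) x hx
  have h2 := hsup.le_on_ball (v := fun x => -v x) (h := fun x => -evalAt p x + ε) hn hv.neg
    (hP.neg.add contDiff_const)
    (fun x => by rw [lap_add hP.neg.contDiffAt contDiffAt_const, lap_neg hP.contDiffAt, hl,
      lap_const, neg_zero, add_zero])
    (fun x hx => by linarith [(abs_le.1 (hpv x hx)).1]) x hx
  rw [abs_le]
  constructor <;> linarith

theorem exists_harmonic_near_on_punctured_ball {n : ℕ} (hn : 2 ≤ n)
    {v : EuclideanSpace ℝ (Fin n) → ℝ} {M : ℝ}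
    (hv : ContinuousOn v (Metric.closedBall 0 1 \ {0}))
    (hvM : ∀ x ∈ Metric.closedBall (0 : EuclideanSpace ℝ (Fin n)) 1 \ {0}, |v x| ≤ M)
    (hsub : ViscositySubharmonic (Metric.ball 0 1 \ {0}) v)
    (hsup : ViscositySubharmonic (Metric.ball 0 1 \ {0}) fun x => -v x) {ε : ℝ} (hε : 0 < ε) :
    ∃ p : MvPolynomial (Fin n) ℝ, polyLap p = 0 ∧
      ∀ x ∈ Metric.ball 0 1 \ {0}, |v x - evalAt p x| ≤ ε := by
  obtain ⟨p, hp, hpv⟩ := exists_harmonic_near_on_sphere (c := 0) (R := 1) (by omega) one_pos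
    (hv.mono fun x hx => ⟨Metric.sphere_subset_closedBall hx, fun h => by
      rw [mem_singleton_iff.1 h] at hx; simp at hx⟩) hε
  have hP : ContDiff ℝ 2 (evalAt p) := contDiff_evalAt p
  have hl : ∀ x, lap (evalAt p) x = 0 := fun x => by simp [lap_evalAt, hp, evalAt]
  refine ⟨p, hp, fun x hx => ?_⟩
  have h1 := hsub.le_on_punctured_ball (h := fun x => evalAt p x + ε) hn hv
    (fun x hx => (abs_le.1 (hvM x hx)).2) (hP.add contDiff_const)
    (fun x => by rw [lap_add hP.contDiffAt contDiffAt_const, hl, lap_const, add_zero])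
    (fun x hx => by linarith [(abs_le.1 (hpv x hx)).2]) x hx
  have h2 := hsup.le_on_punctured_ball (v := fun x => -v x) (M := M)
    (h := fun x => -evalAt p x + ε) hn hv.neg
    (fun x hx => by linarith [(abs_le.1 (hvM x hx)).1]) (hP.neg.add contDiff_const)
    (fun x => by rw [lap_add hP.neg.contDiffAt contDiffAt_const, lap_neg hP.contDiffAt, hl,
      lap_const, neg_zero, add_zero])
    (fun x hx => by linarith [(abs_le.1 (hpv x hx)).1]) x hx
  rw [abs_le]
  constructor <;> linarith

open MeasureTheory

/-! ### Mean value property and smoothness -/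

/-- The profile of a radial bump function supported in the ball of radius `r`. -/
def bumpProfile (r t : ℝ) : ℝ := Real.smoothTransition (1 - t / r ^ 2)

/-- A smooth radial bump function supported in the closed ball of radius `r`. -/
def radialBump {n : ℕ} (r : ℝ) (y : EuclideanSpace ℝ (Fin n)) : ℝ := bumpProfile r (‖y‖ ^ 2)

/-- A potential whose gradient is `2 y` times the radial bump function. -/
def radialPotential {n : ℕ} (r : ℝ) (y : EuclideanSpace ℝ (Fin n)) : ℝ :=
  ∫ t in (r ^ 2)..(‖y‖ ^ 2), bumpProfile r t

theorem contDiff_bumpProfile (r : ℝ) {m : ℕ∞} : ContDiff ℝ m (bumpProfile r) :=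
  Real.smoothTransition.contDiff.comp (contDiff_const.sub (contDiff_id.div_const _))

theorem bumpProfile_eq_zero {r t : ℝ} (hr : 0 < r) (h : r ^ 2 ≤ t) : bumpProfile r t = 0 := by
  refine Real.smoothTransition.zero_of_nonpos ?_
  rw [sub_nonpos, le_div_iff₀ (by positivity)]
  linarith

theorem contDiff_radialBump {n : ℕ} (r : ℝ) {m : ℕ∞} :
    ContDiff ℝ m (radialBump (n := n) r) :=
  (contDiff_bumpProfile r).comp (contDiff_norm_sq ℝ)

theorem radialBump_nonneg {n : ℕ} (r : ℝ) (y : EuclideanSpace ℝ (Fin n)) : 0 ≤ radialBump r y :=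
  Real.smoothTransition.nonneg _

theorem radialBump_eq_zero {n : ℕ} {r : ℝ} (hr : 0 < r) {y : EuclideanSpace ℝ (Fin n)}
    (h : r ≤ ‖y‖) : radialBump r y = 0 :=
  bumpProfile_eq_zero hr (by gcongr)

theorem hasCompactSupport_radialBump {n : ℕ} {r : ℝ} (hr : 0 < r) :
    HasCompactSupport (radialBump (n := n) r) :=
  HasCompactSupport.intro (isCompact_closedBall 0 r) fun y hy =>
    radialBump_eq_zero hr (by simpa using (not_le.1 (by simpa using hy)).le)

theorem integral_radialBump_pos {n : ℕ} {r : ℝ} (hr : 0 < r) :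
    0 < ∫ y : EuclideanSpace ℝ (Fin n), radialBump r y :=
  (contDiff_radialBump r (m := 0)).continuous.integral_pos_of_hasCompactSupport_nonneg_nonzero
    (hasCompactSupport_radialBump hr) (radialBump_nonneg r) (x := 0)
    (by simp [radialBump, bumpProfile, Real.smoothTransition.one_of_one_le])

theorem hasFDerivAt_radialPotential {n : ℕ} (r : ℝ) (y : EuclideanSpace ℝ (Fin n)) :
    HasFDerivAt (radialPotential r) ((2 * radialBump r y) • innerSL ℝ y) y :=
  hasFDerivAt_radial (g := fun s => ∫ t in (r ^ 2)..s, bumpProfile r t)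
    ((contDiff_bumpProfile r (m := 0)).continuous.integral_hasStrictDerivAt _ _).hasDerivAt

/-- The lower limit `r²` in the potential serves this purpose: for `|y| > r` the integration runs
only over points where the profile vanishes. -/
theorem hasCompactSupport_radialPotential {n : ℕ} {r : ℝ} (hr : 0 < r) :
    HasCompactSupport (radialPotential (n := n) r) := by
  refine HasCompactSupport.intro (isCompact_closedBall 0 r) fun y hy => ?_
  have hy' : r < ‖y‖ := not_le.1 (by simpa using hy)
  have hsq : r ^ 2 ≤ ‖y‖ ^ 2 := by gcongr
  refine intervalIntegral.integral_zero_ae (Eventually.of_forall fun t ht => ?_)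
  rw [uIoc_of_le hsq] at ht
  exact bumpProfile_eq_zero hr ht.1.le

theorem continuous_radialPotential {n : ℕ} (r : ℝ) : Continuous (radialPotential (n := n) r) :=
  continuous_iff_continuousAt.2 fun y => (hasFDerivAt_radialPotential r y).continuousAt

/-- With `η` the bump and `ζ` the potential, `y η(y) = ½ ∇ζ(y)`. Integration by parts gives `-(s/2)
∫ Δf(x + s y) ζ(y) dy`, which is zero. -/
theorem integral_gradient_radialBump {n : ℕ} {f : EuclideanSpace ℝ (Fin n) → ℝ}
    (hf : ContDiff ℝ 2 f) (hl : ∀ x, lap f x = 0) {r : ℝ} (hr : 0 < r)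
    (x : EuclideanSpace ℝ (Fin n)) (s : ℝ) :
    ∫ y, fderiv ℝ f (x + s • y) y * radialBump r y = 0 := by
  have hA : ∀ y : EuclideanSpace ℝ (Fin n),
      HasFDerivAt (fun y : EuclideanSpace ℝ (Fin n) => x + s • y)
        (s • ContinuousLinearMap.id ℝ _) y := fun y =>
    ((hasFDerivAt_id y).const_smul s).const_add x
  set G : Fin n → EuclideanSpace ℝ (Fin n) → ℝ :=
    fun i y => fderiv ℝ f (x + s • y) (EuclideanSpace.single i 1) with hG
  have hG1 : ∀ i, ContDiff ℝ 1 (G i) := fun i =>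
    ((hf.fderiv_right (m := 1) (by norm_num)).comp (by fun_prop)).clm_apply contDiff_const
  have hGd : ∀ i y, fderiv ℝ (G i) y (EuclideanSpace.single i 1) =
      s * hessian f (x + s • y) i i := by
    intro i y
    have h1 := (differentiableAt_fderiv (hf.contDiffAt (x := x + s • y))).hasFDerivAt
    have h2 := HasFDerivAt.comp y h1 (hA y)
    have h3 := h2.clm_apply (hasFDerivAt_const (EuclideanSpace.single i (1 : ℝ)) y)
    refine (DFunLike.congr_fun h3.fderiv (EuclideanSpace.single i 1)).trans ?_
    simp [hessian]
  have hζ : ∀ (i : Fin n) (y : EuclideanSpace ℝ (Fin n)),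
      fderiv ℝ (radialPotential r) y (EuclideanSpace.single i 1) =
      2 * radialBump r y * y i := fun i y => by
    rw [(hasFDerivAt_radialPotential r y).fderiv]
    simp [EuclideanSpace.inner_single_right]
  have hηc : Continuous (radialBump (n := n) r) := (contDiff_radialBump r (m := 0)).continuous
  have hζc := continuous_radialPotential (n := n) r
  have hi1 : ∀ i, Integrable fun y => G i y * (2 * radialBump r y * y i) := fun i =>
    ((hG1 i).continuous.mul (by fun_prop)).integrable_of_hasCompactSupport
      (((hasCompactSupport_radialBump hr).mul_left (f := fun _ => 2)).mul_right.mul_left)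
  have hGc : ∀ i, Continuous fun y => fderiv ℝ (G i) y (EuclideanSpace.single i 1) := fun i =>
    ((hG1 i).continuous_fderiv (by norm_num)).clm_apply continuous_const
  have hi2 : ∀ i, Integrable fun y => fderiv ℝ (G i) y (EuclideanSpace.single i 1) *
      radialPotential r y := fun i =>
    ((hGc i).mul hζc).integrable_of_hasCompactSupport
      (hasCompactSupport_radialPotential hr).mul_left
  have hi3 : ∀ i, Integrable fun y => G i y * radialPotential r y := fun i =>
    ((hG1 i).continuous.mul hζc).integrable_of_hasCompactSupport
      (hasCompactSupport_radialPotential hr).mul_left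
  have hparts : ∀ i, ∫ y, G i y * (2 * radialBump r y * y i) =
      -∫ y, fderiv ℝ (G i) y (EuclideanSpace.single i 1) * radialPotential r y := by
    intro i
    have := integral_mul_fderiv_eq_neg_fderiv_mul_of_integrable (μ := volume) (f := G i)
      (g := radialPotential r) (v := EuclideanSpace.single i 1) (hi2 i)
      (by simpa only [hζ] using hi1 i) (hi3 i)
      (fun y _ => (hG1 i).differentiable (by norm_num) y)
      (fun y _ => (hasFDerivAt_radialPotential r y).differentiableAt)
    simpa only [hζ] using this
  have hexp : ∀ y : EuclideanSpace ℝ (Fin n), fderiv ℝ f (x + s • y) y * radialBump r y =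
      (1 / 2) * ∑ i, G i y * (2 * radialBump r y * y i) := by
    intro y
    have hy : y = ∑ i, y i • EuclideanSpace.single i (1 : ℝ) := by
      simpa using ((EuclideanSpace.basisFun (Fin n) ℝ).sum_repr y).symm
    have : fderiv ℝ f (x + s • y) y = ∑ i, y i * G i y := by
      conv_lhs => rw [congrArg (fderiv ℝ f (x + s • y)) hy]
      simp [hG]
    rw [this, Finset.sum_mul, Finset.mul_sum]
    exact Finset.sum_congr rfl fun i _ => by ring
  simp_rw [hexp]
  rw [integral_const_mul, integral_finsetSum _ fun i _ => hi1 i]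
  simp_rw [hparts]
  rw [Finset.sum_neg_distrib, ← integral_finsetSum _ fun i _ => hi2 i]
  simp_rw [hGd, ← Finset.sum_mul, ← Finset.mul_sum]
  have hl' : ∀ y, ∑ i, hessian f (x + s • y) i i = 0 := fun y => hl _
  simp [hl']

/-- A mean value property without spherical integrals: by the preceding lemma `s ↦ ∫ f(x + s y) η(y)
dy` has zero derivative. The values at `s = -1` and `s = 0` are the two sides. -/
theorem integral_mul_radialBump {n : ℕ} {f : EuclideanSpace ℝ (Fin n) → ℝ}
    (hf : ContDiff ℝ 2 f) (hl : ∀ x, lap f x = 0) {r : ℝ} (hr : 0 < r)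
    (x : EuclideanSpace ℝ (Fin n)) :
    ∫ y, f (x - y) * radialBump r y = f x * ∫ y : EuclideanSpace ℝ (Fin n), radialBump r y := by
  have hηc : Continuous (radialBump (n := n) r) := (contDiff_radialBump r (m := 0)).continuous
  have hfc := hf.continuous
  have hf'c := hf.continuous_fderiv (by norm_num)
  have hint : ∀ s : ℝ, Integrable fun y => f (x + s • y) * radialBump r y := fun s =>
    (by fun_prop : Continuous fun y => f (x + s • y) * radialBump r y
      ).integrable_of_hasCompactSupport (hasCompactSupport_radialBump hr).mul_left
  have hder : ∀ s₀ : ℝ, HasDerivAt (fun s : ℝ => ∫ y, f (x + s • y) * radialBump r y) 0 s₀ := by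
    intro s₀
    have hcont : Continuous fun q : ℝ × EuclideanSpace ℝ (Fin n) =>
        fderiv ℝ f (x + q.1 • q.2) q.2 * radialBump r q.2 :=
      ((hf'c.comp (by fun_prop)).clm_apply continuous_snd).mul (hηc.comp continuous_snd)
    obtain ⟨C, hC⟩ := ((isCompact_closedBall s₀ 1).prod
      (isCompact_closedBall (0 : EuclideanSpace ℝ (Fin n)) r)).exists_bound_of_continuousOn
        hcont.continuousOn
    have h := (hasDerivAt_integral_of_dominated_loc_of_deriv_le (μ := volume)
      (F := fun s y => f (x + s • y) * radialBump r y)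
      (F' := fun s y => fderiv ℝ f (x + s • y) y * radialBump r y)
      (bound := (Metric.closedBall 0 r).indicator fun _ => C)
      (Metric.ball_mem_nhds s₀ one_pos)
      (Eventually.of_forall fun s => (hint s).aestronglyMeasurable) (hint s₀)
      (hcont.comp (by fun_prop : Continuous fun y => (s₀, y))).aestronglyMeasurable
      (Eventually.of_forall fun y s hs => ?_) ?_
      (Eventually.of_forall fun y s hs => ?_)).2
    · rwa [integral_gradient_radialBump hf hl hr] at h
    · by_cases hy : y ∈ Metric.closedBall 0 r
      · rw [indicator_of_mem hy]
        exact hC (s, y) ⟨Metric.ball_subset_closedBall hs, hy⟩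
      · rw [indicator_of_notMem hy, radialBump_eq_zero hr
          (by simpa using (not_le.1 (by simpa using hy)).le)]
        simp
    · exact (integrable_indicator_iff measurableSet_closedBall).2
        (integrableOn_const (isCompact_closedBall _ _).measure_lt_top.ne)
    · have h1 : HasDerivAt (fun s : ℝ => x + s • y) y s := by
        simpa using ((hasDerivAt_id s).smul_const y).const_add x
      exact (((hf.differentiable (by norm_num)) _).hasFDerivAt.comp_hasDerivAt s h1).mul_const _
  have h := is_const_of_deriv_eq_zero (fun s => (hder s).differentiableAt)
    (fun s => (hder s).deriv) (-1) 0
  simpa [← sub_eq_add_neg, integral_const_mul] using h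

/-- The mean value identity is exact for harmonic polynomials and stable under uniform limits, so
`v` equals its normalized convolution with a smooth bump. With `r = R - R'` the bump centred in the
smaller ball only sees the larger one. The set `S` may miss a null set, which allows for a puncture.
-/
theorem exists_contDiff_eq_of_harmonic_near {n : ℕ} {c : EuclideanSpace ℝ (Fin n)} {R : ℝ}
    {S : Set (EuclideanSpace ℝ (Fin n))} (hSm : MeasurableSet S) (hSR : S ⊆ Metric.ball c R)
    (hS0 : volume (Metric.ball c R \ S) = 0) {v : EuclideanSpace ℝ (Fin n) → ℝ}
    (hv : ContinuousOn v S)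
    (happ : ∀ ε > 0, ∃ p : MvPolynomial (Fin n) ℝ, polyLap p = 0 ∧
      ∀ x ∈ S, |v x - evalAt p x| ≤ ε) {R' : ℝ} (hR' : R' < R) :
    ∃ w : EuclideanSpace ℝ (Fin n) → ℝ, ContDiff ℝ ∞ w ∧
      ∀ x ∈ S ∩ Metric.ball c R', w x = v x := by
  set r := R - R' with hrdef
  have hr : 0 < r := sub_pos.2 hR'
  set I := ∫ y : EuclideanSpace ℝ (Fin n), radialBump r y with hIdef
  have hI : 0 < I := integral_radialBump_pos hr
  have hηc : Continuous (radialBump (n := n) r) := (contDiff_radialBump r (m := 0)).continuous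
  have hηs := hasCompactSupport_radialBump (n := n) hr
  set v₀ := S.indicator v with hv0
  -- Continuity on `S` alone does not bound `v`; closeness to a single polynomial does.
  have hint : Integrable v₀ := by
    obtain ⟨p, -, hp⟩ := happ 1 one_pos
    obtain ⟨C, hC⟩ := (isCompact_closedBall c R).exists_bound_of_continuousOn
      (continuous_evalAt p).continuousOn
    refine (integrable_indicator_iff hSm).2 ?_
    refine IntegrableOn.of_bound ((measure_mono hSR).trans_lt measure_ball_lt_top)
      (hv.aestronglyMeasurable hSm) (C + 1) ?_
    filter_upwards [ae_restrict_mem hSm] with x hx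
    have h1 := hp x hx
    have h2 := hC x (Metric.ball_subset_closedBall (hSR hx))
    rw [Real.norm_eq_abs] at h2 ⊢
    have h3 := abs_sub_abs_le_abs_sub (v x) (evalAt p x)
    linarith
  have hsmooth : ContDiff ℝ ∞
      (convolution v₀ (radialBump r) (ContinuousLinearMap.mul ℝ ℝ) volume) :=
    hηs.contDiff_convolution_right _ hint.locallyIntegrable (contDiff_radialBump r)
  refine ⟨fun x => I⁻¹ * convolution v₀ (radialBump r) (ContinuousLinearMap.mul ℝ ℝ) volume x,
    contDiff_const.mul hsmooth, fun x hx => ?_⟩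
  have hclose : ∀ ε > 0, |I⁻¹ * convolution v₀ (radialBump r) (ContinuousLinearMap.mul ℝ ℝ)
      volume x - v x| ≤ 2 * ε := by
    intro ε hε
    obtain ⟨p, hp, hpv⟩ := happ ε hε
    have hmean : ∫ t, evalAt p t * radialBump r (x - t) = evalAt p x * I := by
      rw [← integral_mul_radialBump (contDiff_evalAt p)
        (fun y => by simp [lap_evalAt, hp, evalAt]) hr x,
        ← integral_sub_left_eq_self (fun t => evalAt p t * radialBump r (x - t)) volume x]
      simp
    have hi1 : Integrable fun t => v₀ t * radialBump r (x - t) :=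
      hηs.convolutionExists_right (ContinuousLinearMap.mul ℝ ℝ) hint.locallyIntegrable hηc x
    have hηx : Integrable fun t => radialBump r (x - t) :=
      (hηc.integrable_of_hasCompactSupport hηs).comp_sub_left x
    have hi2 : Integrable fun t => evalAt p t * radialBump r (x - t) := by
      have hpc := continuous_evalAt p
      have hbase : Integrable fun y => evalAt p (x - y) * radialBump r y :=
        (by fun_prop : Continuous fun y => evalAt p (x - y) * radialBump r y
          ).integrable_of_hasCompactSupport hηs.mul_left
      simpa using hbase.comp_sub_left x
    have hbound : ‖∫ t, (v₀ t * radialBump r (x - t) - evalAt p t * radialBump r (x - t))‖ ≤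
        ∫ t, ε * radialBump r (x - t) := by
      refine norm_integral_le_of_norm_le (hηx.const_mul ε) ?_
      have hae : ∀ᵐ t, t ∉ Metric.ball c R \ S := measure_eq_zero_iff_ae_notMem.1 hS0
      filter_upwards [hae] with t ht
      rw [← sub_mul, norm_mul, Real.norm_of_nonneg (radialBump_nonneg r _)]
      by_cases htr : r ≤ ‖x - t‖
      · simp [radialBump_eq_zero hr htr]
      refine mul_le_mul_of_nonneg_right ?_ (radialBump_nonneg r _)
      have htS : t ∈ S := by
        by_contra hnot
        refine ht ⟨?_, hnot⟩
        have h1 : dist x c < R' := hx.2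
        have h2 : dist t x < r := by rw [dist_comm, dist_eq_norm]; exact not_le.1 htr
        have h3 := dist_triangle t x c
        rw [Metric.mem_ball]
        linarith
      rw [hv0, indicator_of_mem htS]
      exact hpv t htS
    rw [integral_sub hi1 hi2, hmean, integral_const_mul,
      integral_sub_left_eq_self (radialBump r) volume x, ← hIdef] at hbound
    have hconv : convolution v₀ (radialBump r) (ContinuousLinearMap.mul ℝ ℝ) volume x =
      ∫ t, v₀ t * radialBump r (x - t) := rfl
    rw [← hconv, Real.norm_eq_abs] at hbound
    have h1 := hpv x hx.1
    have h2 : |I⁻¹ * convolution v₀ (radialBump r) (ContinuousLinearMap.mul ℝ ℝ) volume x -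
        evalAt p x| ≤ ε := by
      have : I⁻¹ * convolution v₀ (radialBump r) (ContinuousLinearMap.mul ℝ ℝ) volume x -
        evalAt p x = I⁻¹ * (convolution v₀ (radialBump r) (ContinuousLinearMap.mul ℝ ℝ) volume x -
          evalAt p x * I) := by field_simp
      rw [this, abs_mul, abs_of_pos (inv_pos.2 hI), inv_mul_le_iff₀ hI]
      linarith
    have h3 := abs_sub_le (I⁻¹ * convolution v₀ (radialBump r) (ContinuousLinearMap.mul ℝ ℝ)
      volume x) (evalAt p x) (v x)
    rw [abs_sub_comm (evalAt p x)] at h3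
    linarith
  have h0 : |I⁻¹ * convolution v₀ (radialBump r) (ContinuousLinearMap.mul ℝ ℝ)
      volume x - v x| ≤ 0 :=
    le_of_forall_pos_le_add fun ε hε => by linarith [hclose (ε / 2) (by linarith)]
  exact sub_eq_zero.1 (abs_nonpos_iff.1 h0)

/-! ### Regularity of viscosity harmonic functions -/

theorem contDiffAt_of_viscosity_harmonic {n : ℕ} (hn : 0 < n)
    {U : Set (EuclideanSpace ℝ (Fin n))} (hU : IsOpen U) {v : EuclideanSpace ℝ (Fin n) → ℝ}
    (hv : ContinuousOn v U) (hsub : ViscositySubharmonic U v)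
    (hsup : ViscositySubharmonic U fun x => -v x) {x : EuclideanSpace ℝ (Fin n)} (hx : x ∈ U) :
    ContDiffAt ℝ ∞ v x := by
  obtain ⟨R, hR, hRU⟩ := Metric.nhds_basis_closedBall.mem_iff.1 (hU.mem_nhds hx)
  have hbU := Metric.ball_subset_closedBall.trans hRU
  obtain ⟨w, hw, hwv⟩ := exists_contDiff_eq_of_harmonic_near (S := Metric.ball x R)
    measurableSet_ball subset_rfl (by simp) (hv.mono hbU)
    (fun ε hε => exists_harmonic_near_on_ball hn hR (hv.mono hRU) (hsub.mono hbU)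
      (hsup.mono hbU) hε) (half_lt_self hR)
  refine hw.contDiffAt.congr_of_eventuallyEq ?_
  filter_upwards [Metric.ball_mem_nhds x hR, Metric.ball_mem_nhds x (half_pos hR)] with y h1 h2
  exact (hwv y ⟨h1, h2⟩).symm

theorem lap_eq_zero_of_viscosity_harmonic {n : ℕ}
    {U : Set (EuclideanSpace ℝ (Fin n))} {v : EuclideanSpace ℝ (Fin n) → ℝ}
    (hsub : ViscositySubharmonic U v) (hsup : ViscositySubharmonic U fun x => -v x)
    {x : EuclideanSpace ℝ (Fin n)} (hx : x ∈ U) (hv : ContDiffAt ℝ 2 v x) : lap v x = 0 := by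
  have h1 := hsub x hx v hv rfl (Eventually.of_forall fun _ => le_rfl)
  have h2 := hsup x hx (fun y => -v y) hv.neg rfl (Eventually.of_forall fun _ => le_rfl)
  rw [lap_neg hv] at h2
  linarith

/-- Removable singularities. -/
theorem exists_contDiff_extension {n : ℕ} (hn : 2 ≤ n) {v : EuclideanSpace ℝ (Fin n) → ℝ} {M : ℝ}
    (hv : ContinuousOn v {0}ᶜ)
    (hvM : ∀ x ∈ Metric.closedBall (0 : EuclideanSpace ℝ (Fin n)) 1 \ {0}, |v x| ≤ M)
    (hsub : ViscositySubharmonic {0}ᶜ v) (hsup : ViscositySubharmonic {0}ᶜ fun x => -v x) :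
    ∃ w : EuclideanSpace ℝ (Fin n) → ℝ, ContDiff ℝ ∞ w ∧ ∀ᶠ x in 𝓝 0, x ≠ 0 → w x = v x := by
  have : NeZero n := ⟨by omega⟩
  have hS : Metric.ball (0 : EuclideanSpace ℝ (Fin n)) 1 \ (Metric.ball 0 1 \ {0}) ⊆ {0} := by
    intro x hx
    by_contra h
    exact hx.2 ⟨hx.1, h⟩
  obtain ⟨w, hw, hwv⟩ := exists_contDiff_eq_of_harmonic_near (c := 0) (R := 1) (R' := 1 / 2)
    (S := Metric.ball 0 1 \ {0})
    (measurableSet_ball.diff (measurableSet_singleton 0)) sdiff_subset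
    (measure_mono_null hS (measure_singleton 0)) (hv.mono fun x hx => hx.2)
    (fun ε hε => exists_harmonic_near_on_punctured_ball hn (hv.mono fun x hx => hx.2) hvM
      (hsub.mono fun x hx => hx.2) (hsup.mono fun x hx => hx.2) hε) (by norm_num)
  refine ⟨w, hw, ?_⟩
  filter_upwards [Metric.ball_mem_nhds 0 one_pos,
    Metric.ball_mem_nhds 0 (by norm_num : (0 : ℝ) < 1 / 2)] with x h1 h2 h3
  exact hwv x ⟨⟨h1, h3⟩, h2⟩

/-! ### Smooth homogeneous functions are polynomials -/

/-- Only values to the right of zero are known. Differentiating there lowers `k`, and in the base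
case continuity of `f` at zero identifies `f 0` with the right limit. -/
theorem iteratedDeriv_of_eq_pow {f : ℝ → ℝ} (hf : ContDiff ℝ ∞ f) {c δ : ℝ} (hδ : 0 < δ) (k : ℕ)
    (h : ∀ t ∈ Ioo 0 δ, f t = t ^ k * c) : iteratedDeriv k f 0 = k.factorial * c := by
  induction k generalizing f c with
  | zero =>
    have h1 : Tendsto f (𝓝[>] 0) (𝓝 (f 0)) := hf.continuous.continuousWithinAt
    have h2 : Tendsto f (𝓝[>] 0) (𝓝 c) := tendsto_const_nhds.congr' (by
      filter_upwards [Ioo_mem_nhdsGT hδ] with t ht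
      simp [h t ht])
    simpa using tendsto_nhds_unique h1 h2
  | succ k ih =>
    have hf' : ContDiff ℝ ∞ (deriv f) := by
      rw [contDiff_infty_iff_deriv] at hf
      exact hf.2
    rw [iteratedDeriv_succ', ih hf' (c := (k + 1 : ℕ) * c) fun t ht => ?_, Nat.factorial_succ]
    · push_cast; ring
    · have : f =ᶠ[𝓝 t] fun t => t ^ (k + 1) * c := by
        filter_upwards [isOpen_Ioo.mem_nhds ht] with s hs
        exact h s hs
      rw [this.deriv_eq]
      simp
      ring

/-- Differentiating until the exponent is negative leaves a function that stays bounded at zero only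
if its coefficient vanishes. The factors produced on the way are nonzero because the exponent is
never a natural number. -/
theorem eq_zero_of_eq_rpow {f : ℝ → ℝ} (hf : ContDiff ℝ ∞ f) {c δ d : ℝ} (hδ : 0 < δ)
    (hd : ¬ ∃ k : ℕ, d = k) (h : ∀ t ∈ Ioo 0 δ, f t = t ^ d * c) : c = 0 := by
  obtain ⟨m, hm⟩ := exists_nat_gt d
  induction m generalizing f c d with
  | zero =>
    by_contra hc
    have h1 : Tendsto f (𝓝[>] 0) (𝓝 (f 0)) := hf.continuous.continuousWithinAt
    have h2 : Tendsto (fun t : ℝ => f t * t ^ (-d)) (𝓝[>] 0) (𝓝 (f 0 * 0)) := by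
      refine h1.mul ?_
      have : ContinuousAt (fun t : ℝ => t ^ (-d)) 0 :=
        Real.continuousAt_rpow_const _ _ (Or.inr (by simpa using hm.le))
      have hd0 : -d ≠ 0 := by
        have : d < 0 := by simpa using hm
        linarith
      simpa [ContinuousAt, Real.zero_rpow hd0] using this.tendsto.mono_left nhdsWithin_le_nhds
    have h3 : Tendsto (fun t : ℝ => f t * t ^ (-d)) (𝓝[>] 0) (𝓝 c) :=
      tendsto_const_nhds.congr' (by
        filter_upwards [Ioo_mem_nhdsGT hδ] with t ht
        rw [h t ht, Real.rpow_neg ht.1.le]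
        have := (Real.rpow_pos_of_pos ht.1 d).ne'
        field_simp)
    exact hc (by simpa using tendsto_nhds_unique h3 h2)
  | succ m ih =>
    have hf' : ContDiff ℝ ∞ (deriv f) := by
      rw [contDiff_infty_iff_deriv] at hf
      exact hf.2
    have hd0 : d ≠ 0 := fun h0 => hd ⟨0, by simpa using h0⟩
    have := ih hf' (c := d * c) (d := d - 1)
      (fun ⟨k, hk⟩ => hd ⟨k + 1, by push_cast; linarith⟩) (fun t ht => ?_)
      (by push_cast at hm; linarith)
    · simpa [hd0] using this
    · have he : f =ᶠ[𝓝 t] fun t => t ^ d * c := by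
        filter_upwards [isOpen_Ioo.mem_nhds ht] with s hs
        exact h s hs
      rw [he.deriv_eq, ((Real.hasDerivAt_rpow_const (Or.inl ht.1.ne')).mul_const c).deriv]
      ring

theorem exists_polynomial_of_multilinear {n k : ℕ}
    (D : ContinuousMultilinearMap ℝ (fun _ : Fin k => EuclideanSpace ℝ (Fin n)) ℝ) :
    ∃ p : MvPolynomial (Fin n) ℝ, p.IsHomogeneous k ∧ ∀ x, evalAt p x = D fun _ => x := by
  refine ⟨∑ f : Fin k → Fin n, MvPolynomial.C (D fun i => EuclideanSpace.single (f i) 1) *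
    ∏ i, MvPolynomial.X (f i), ?_, fun x => ?_⟩
  · refine MvPolynomial.IsHomogeneous.sum _ _ _ fun f _ => ?_
    have h := MvPolynomial.IsHomogeneous.prod (R := ℝ) Finset.univ
      (fun i => MvPolynomial.X (f i)) (fun _ => 1) fun i _ => MvPolynomial.isHomogeneous_X ℝ (f i)
    simpa using (MvPolynomial.isHomogeneous_C _ _).mul h
  · have hx : x = ∑ i, x i • EuclideanSpace.single i (1 : ℝ) := by
      simpa using ((EuclideanSpace.basisFun (Fin n) ℝ).sum_repr x).symm
    conv_rhs => rw [hx]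
    rw [D.map_sum]
    simp only [D.map_smul_univ, evalAt, map_sum, map_mul, map_prod, MvPolynomial.eval_C,
      MvPolynomial.eval_X, smul_eq_mul]
    exact Finset.sum_congr rfl fun f _ => mul_comm _ _

/-- On each ray the smooth extension `w` equals `t^d v(x)` for small `t > 0`, which reduces the
question to one variable. The polynomial is the Taylor term of order `k` of `w` at the origin. -/
theorem homogeneous_classification {n : ℕ} (hn : 0 < n) {d : ℝ}
    {v w : EuclideanSpace ℝ (Fin n) → ℝ} (hhom : HomogeneousOfDegree d v)
    (hl : ∀ x, x ≠ 0 → lap v x = 0) (hw : ContDiff ℝ ∞ w)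
    (hwv : ∀ᶠ x in 𝓝 0, x ≠ 0 → w x = v x) :
    (∀ x, x ≠ 0 → v x = 0) ∨ ∃ k : ℕ, d = k ∧ ∃ p : MvPolynomial (Fin n) ℝ,
      IsHomogeneousHarmonic k p ∧ ∀ x, x ≠ 0 → v x = evalAt p x := by
  have hray : ∀ x : EuclideanSpace ℝ (Fin n), x ≠ 0 → ∃ δ > 0, ∀ t ∈ Ioo (0 : ℝ) δ,
      w (t • x) = t ^ d * v x := by
    intro x hx
    have hc : Tendsto (fun t : ℝ => t • x) (𝓝 0) (𝓝 0) := by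
      have : Continuous fun t : ℝ => t • x := by fun_prop
      simpa using this.tendsto 0
    obtain ⟨δ, hδ, h⟩ := Metric.eventually_nhds_iff.1 (hc.eventually hwv)
    refine ⟨δ, hδ, fun t ht => ?_⟩
    rw [h (by simpa [abs_of_pos ht.1] using ht.2) (smul_ne_zero ht.1.ne' hx), hhom t ht.1 x hx]
  have hsm : ∀ x : EuclideanSpace ℝ (Fin n), ContDiff ℝ ∞ fun t : ℝ => w (t • x) :=
    fun x => hw.comp (contDiff_id.smul contDiff_const)
  by_cases hd : ∃ k : ℕ, d = k
  · obtain ⟨k, rfl⟩ := hd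
    right
    obtain ⟨p, hp, hpe⟩ := exists_polynomial_of_multilinear
      ((k.factorial : ℝ)⁻¹ • iteratedFDeriv ℝ k w 0)
    have hval : ∀ x, x ≠ 0 → v x = evalAt p x := by
      intro x hx
      obtain ⟨δ, hδ, h⟩ := hray x hx
      have h1 := iteratedDeriv_of_eq_pow (hsm x) hδ k (c := v x)
        (fun t ht => by rw [h t ht, Real.rpow_natCast])
      let L : ℝ →L[ℝ] EuclideanSpace ℝ (Fin n) := ContinuousLinearMap.toSpanSingleton ℝ x
      have h2 : iteratedDeriv k (fun t : ℝ => w (t • x)) 0 =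
          iteratedFDeriv ℝ k w 0 fun _ => x := by
        have := L.iteratedFDeriv_comp_right hw (0 : ℝ) (i := k)
          (by exact_mod_cast le_top)
        have h3 := DFunLike.congr_fun this fun _ => (1 : ℝ)
        simpa [L, iteratedDeriv_eq_iteratedFDeriv, Function.comp_def] using h3
      rw [hpe]
      have hk : (k.factorial : ℝ) ≠ 0 := by positivity
      simp only [smul_apply, smul_eq_mul, ← h2, h1]
      field_simp
    refine ⟨k, rfl, p, ⟨hp, ?_⟩, hval⟩
    rw [← polyLap_apply]
    -- The open unit ball about a unit vector avoids the origin, so the equation for `v` is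
    -- available on it.
    refine eq_zero_of_evalAt_ball (c := EuclideanSpace.single ⟨0, hn⟩ 1) one_pos fun x hx => ?_
    have hx0 : x ≠ 0 := by
      rintro rfl
      simp [dist_eq_norm] at hx
    rw [← lap_evalAt, ← hl x hx0]
    refine lap_congr ?_
    filter_upwards [isOpen_ne.mem_nhds hx0] with y hy
    exact (hval y hy).symm
  · left
    intro x hx
    obtain ⟨δ, hδ, h⟩ := hray x hx
    exact eq_zero_of_eq_rpow (hsm x) hδ hd h

/-! ### Powers of the norm and the Kelvin transform -/

theorem norm_rpow_eq {n : ℕ} (s : ℝ) :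
    (fun x : EuclideanSpace ℝ (Fin n) => ‖x‖ ^ s) = fun x => (‖x‖ ^ 2) ^ (s / 2) := by
  ext x
  rw [← Real.rpow_natCast, ← Real.rpow_mul (norm_nonneg x)]
  congr 1
  push_cast
  ring

theorem contDiffAt_norm_rpow {n : ℕ} (s : ℝ) {x : EuclideanSpace ℝ (Fin n)} (hx : x ≠ 0)
    {m : WithTop ℕ∞} : ContDiffAt ℝ m (fun x : EuclideanSpace ℝ (Fin n) => ‖x‖ ^ s) x := by
  rw [norm_rpow_eq]
  exact (contDiff_norm_sq ℝ).contDiffAt.rpow_const_of_ne (by simpa using hx)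

theorem fderiv_norm_rpow {n : ℕ} (s : ℝ) {x : EuclideanSpace ℝ (Fin n)} (hx : x ≠ 0)
    (y : EuclideanSpace ℝ (Fin n)) :
    fderiv ℝ (fun x : EuclideanSpace ℝ (Fin n) => ‖x‖ ^ s) x y =
      s * (‖x‖ ^ s / ‖x‖ ^ 2) * inner ℝ x y := by
  have hx0 : 0 < ‖x‖ ^ 2 := by
    have : 0 < ‖x‖ := norm_pos_iff.2 hx
    positivity
  have h := hasFDerivAt_radial (x := x) (g := fun t => t ^ (s / 2))
    (Real.hasDerivAt_rpow_const (Or.inl hx0.ne'))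
  have he := congrFun (norm_rpow_eq (n := n) s) x
  rw [norm_rpow_eq, h.fderiv]
  rw [he, Real.rpow_sub_one hx0.ne']
  simp only [smul_apply, innerSL_apply_apply, smul_eq_mul]
  ring

theorem lap_norm_rpow {n : ℕ} (s : ℝ) {x : EuclideanSpace ℝ (Fin n)} (hx : x ≠ 0) :
    lap (fun x : EuclideanSpace ℝ (Fin n) => ‖x‖ ^ s) x =
      s * (s + n - 2) * (‖x‖ ^ s / ‖x‖ ^ 2) := by
  have hx0 : 0 < ‖x‖ ^ 2 := by
    have : 0 < ‖x‖ := norm_pos_iff.2 hx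
    positivity
  have he := congrFun (norm_rpow_eq (n := n) s) x
  rw [norm_rpow_eq, lap_radial (g := fun t => t ^ (s / 2))
    (g' := fun t => s / 2 * t ^ (s / 2 - 1))
    (g'' := s / 2 * ((s / 2 - 1) * (‖x‖ ^ 2) ^ (s / 2 - 1 - 1)))
    ((lt_mem_nhds hx0).mono fun t ht => Real.hasDerivAt_rpow_const (Or.inl ht.ne'))
    ((Real.hasDerivAt_rpow_const (Or.inl hx0.ne')).const_mul _), he,
    Real.rpow_sub_one hx0.ne', Real.rpow_sub_one hx0.ne']
  field_simp
  ring

/-- Euler's identity. -/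
theorem HomogeneousOfDegree.fderiv_apply_self {n : ℕ} {d : ℝ} {v : EuclideanSpace ℝ (Fin n) → ℝ}
    (hhom : HomogeneousOfDegree d v) {x : EuclideanSpace ℝ (Fin n)} (hx : x ≠ 0)
    (hv : DifferentiableAt ℝ v x) : fderiv ℝ v x x = d * v x := by
  have h1 : HasDerivAt (fun t : ℝ => v (t • x)) (fderiv ℝ v x x) 1 := by
    have hl : HasDerivAt (fun t : ℝ => t • x) x 1 := by
      simpa using (hasDerivAt_id (1 : ℝ)).smul_const x
    have hv' : HasFDerivAt v (fderiv ℝ v x) ((1 : ℝ) • x) := by simpa using hv.hasFDerivAt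
    exact hv'.comp_hasDerivAt 1 hl
  have h2 : HasDerivAt (fun t : ℝ => v (t • x)) (d * v x) 1 := by
    have := (Real.hasDerivAt_rpow_const (x := 1) (p := d) (Or.inl one_ne_zero)).mul_const (v x)
    rw [Real.one_rpow, mul_one] at this
    refine this.congr_of_eventuallyEq ?_
    filter_upwards [lt_mem_nhds (zero_lt_one' ℝ)] with t ht
    exact hhom t ht x hx
  exact h1.unique h2

/-- For homogeneous `v` the Kelvin transform is multiplication by `|x|^s` with `s = 2 - n - 2d`. By
Euler's identity the Laplacian is `s(s + n - 2 + 2d)|x|^(s-2) v`, and the bracket vanishes. -/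
theorem lap_kelvin {n : ℕ} {d : ℝ} {v : EuclideanSpace ℝ (Fin n) → ℝ}
    (hhom : HomogeneousOfDegree d v) {x : EuclideanSpace ℝ (Fin n)} (hx : x ≠ 0)
    (hv : ContDiffAt ℝ 2 v x) (hl : lap v x = 0) :
    lap (fun y => ‖y‖ ^ (2 - (n : ℝ) - 2 * d) * v y) x = 0 := by
  have hsum : ∑ i, x i * fderiv ℝ v x (EuclideanSpace.single i 1) = d * v x := by
    rw [← hhom.fderiv_apply_self hx (hv.differentiableAt (by norm_num))]
    have hx' : x = ∑ i, x i • EuclideanSpace.single i (1 : ℝ) := by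
      simpa using ((EuclideanSpace.basisFun (Fin n) ℝ).sum_repr x).symm
    conv_rhs => rw [congrArg (fderiv ℝ v x) hx']
    simp
  rw [lap_mul (contDiffAt_norm_rpow _ hx) hv, hl, lap_norm_rpow _ hx]
  simp only [fderiv_norm_rpow _ hx, EuclideanSpace.inner_single_right, mul_assoc,
    ← Finset.mul_sum]
  simp only [one_mul, conj_trivial, hsum]
  ring

theorem HomogeneousOfDegree.norm_rpow_mul {n : ℕ} {d : ℝ} {v : EuclideanSpace ℝ (Fin n) → ℝ}
    (hhom : HomogeneousOfDegree d v) (s : ℝ) :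
    HomogeneousOfDegree (s + d) fun y => ‖y‖ ^ s * v y := by
  intro t ht x hx
  simp only
  rw [hhom t ht x hx, norm_smul, Real.norm_of_nonneg ht.le,
    Real.mul_rpow ht.le (norm_nonneg x), Real.rpow_add ht]
  ring

theorem HomogeneousOfDegree.neg {n : ℕ} {d : ℝ} {v : EuclideanSpace ℝ (Fin n) → ℝ}
    (hhom : HomogeneousOfDegree d v) : HomogeneousOfDegree d fun y => -v y := by
  intro t ht x hx
  simp only
  rw [hhom t ht x hx]
  ring

/-- With `x₀` a maximum point on the unit sphere, `v(x₀)|x|^d` touches `v` from above at `x₀`. This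
is the test function for the vanishing result and for `F(0) = 0`, and it bounds `v` near the origin
when `d ≥ 0`. -/
theorem HomogeneousOfDegree.exists_le_norm_rpow {n : ℕ} (hn : 0 < n) {d : ℝ}
    {v : EuclideanSpace ℝ (Fin n) → ℝ}
    (hhom : HomogeneousOfDegree d v) (hv : ContinuousOn v {0}ᶜ) :
    ∃ x₀ : EuclideanSpace ℝ (Fin n), x₀ ≠ 0 ∧ v x₀ * ‖x₀‖ ^ d = v x₀ ∧
      ∀ x, x ≠ 0 → v x ≤ v x₀ * ‖x‖ ^ d := by
  have : NeZero n := ⟨hn.ne'⟩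
  have hne : ∀ x ∈ Metric.sphere (0 : EuclideanSpace ℝ (Fin n)) 1, x ≠ 0 := fun x hx =>
    ne_zero_of_mem_unit_sphere ⟨x, hx⟩
  obtain ⟨x₀, hx₀, hmax⟩ := (isCompact_sphere (0 : EuclideanSpace ℝ (Fin n)) 1).exists_isMaxOn
    (NormedSpace.sphere_nonempty.2 zero_le_one) (hv.mono hne)
  have hx₀1 : ‖x₀‖ = 1 := by simpa using hx₀
  refine ⟨x₀, hne x₀ hx₀, by simp [hx₀1], fun x hx => ?_⟩
  have hpos : 0 < ‖x‖ := norm_pos_iff.2 hx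
  have h1 : v (‖x‖⁻¹ • x) ≤ v x₀ := hmax (by simp [norm_smul, hpos.ne'])
  have h2 := hhom ‖x‖ hpos (‖x‖⁻¹ • x) (smul_ne_zero (inv_ne_zero hpos.ne') hx)
  rw [smul_inv_smul₀ hpos.ne'] at h2
  rw [h2, mul_comm]
  exact mul_le_mul_of_nonneg_right h1 (by positivity)

/-- The radial test function has Laplacian `v(x₀) d(d+n-2)|x₀|^(d-2)`, which would be negative if
the maximum `v(x₀)` were positive. -/
theorem ViscositySubharmonic.nonpos_of_homogeneous {n : ℕ} (hn : 0 < n) {d : ℝ}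
    {v : EuclideanSpace ℝ (Fin n) → ℝ} (hhom : HomogeneousOfDegree d v)
    (hv : ContinuousOn v {0}ᶜ) (hsub : ViscositySubharmonic {0}ᶜ v)
    (hd : d * (d + n - 2) < 0) : ∀ x, x ≠ 0 → v x ≤ 0 := by
  obtain ⟨x₀, hx₀, he, hle⟩ := hhom.exists_le_norm_rpow hn hv
  have h := hsub x₀ hx₀ (fun x => v x₀ * ‖x‖ ^ d)
    (contDiffAt_const.mul (contDiffAt_norm_rpow d hx₀)) he
    ((eventually_ne_nhds hx₀).mono hle)
  rw [lap_const_mul _ (contDiffAt_norm_rpow d hx₀), lap_norm_rpow d hx₀] at h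
  have hpos : 0 < ‖x₀‖ := norm_pos_iff.2 hx₀
  have hneg : d * (d + n - 2) * (‖x₀‖ ^ d / ‖x₀‖ ^ 2) < 0 :=
    mul_neg_of_neg_of_pos hd (by positivity)
  have hv0 : v x₀ ≤ 0 := by
    by_contra! hp
    linarith [mul_neg_of_pos_of_neg hp hneg]
  intro x hx
  exact (hle x hx).trans (mul_nonpos_of_nonpos_of_nonneg hv0 (by positivity))

/-! ### Homogeneous harmonic functions -/

/-- Homogeneous harmonic functions on `ℝⁿ ∖ {0}`, with the equation in the viscosity sense. -/
structure IsHomogeneousViscosityHarmonic {n : ℕ} (d : ℝ) (v : EuclideanSpace ℝ (Fin n) → ℝ) :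
    Prop where
  hom : HomogeneousOfDegree d v
  cont : ContinuousOn v {0}ᶜ
  sub : ViscositySubharmonic {0}ᶜ v
  sup : ViscositySubharmonic {0}ᶜ fun x => -v x

namespace IsHomogeneousViscosityHarmonic

variable {n : ℕ} {d : ℝ} {v : EuclideanSpace ℝ (Fin n) → ℝ}

theorem contDiffAt (hn : 0 < n) (h : IsHomogeneousViscosityHarmonic d v)
    {x : EuclideanSpace ℝ (Fin n)} (hx : x ≠ 0) : ContDiffAt ℝ ∞ v x :=
  contDiffAt_of_viscosity_harmonic hn isOpen_ne h.cont h.sub h.sup hx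

theorem contDiffAt_two (hn : 0 < n) (h : IsHomogeneousViscosityHarmonic d v)
    {x : EuclideanSpace ℝ (Fin n)} (hx : x ≠ 0) : ContDiffAt ℝ 2 v x :=
  (h.contDiffAt hn hx).of_le (WithTop.coe_le_coe.2 (le_top : (2 : ℕ∞) ≤ ⊤))

theorem lap_eq_zero (hn : 0 < n) (h : IsHomogeneousViscosityHarmonic d v)
    {x : EuclideanSpace ℝ (Fin n)} (hx : x ≠ 0) : lap v x = 0 :=
  lap_eq_zero_of_viscosity_harmonic h.sub h.sup hx (h.contDiffAt_two hn hx)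

theorem eq_zero_of_neg (hn : 0 < n) (h : IsHomogeneousViscosityHarmonic d v)
    (hd : d * (d + n - 2) < 0) : ∀ x, x ≠ 0 → v x = 0 := fun x hx =>
  le_antisymm (h.sub.nonpos_of_homogeneous hn h.hom h.cont hd x hx)
    (neg_nonpos.1 (h.sup.nonpos_of_homogeneous hn h.hom.neg h.cont.neg hd x hx))

/-- A nonnegative degree keeps `v` bounded near the origin, so the singularity is removable. -/
theorem classification_of_nonneg (hn : 2 ≤ n) (h : IsHomogeneousViscosityHarmonic d v)
    (hd : 0 ≤ d) :
    (∀ x, x ≠ 0 → v x = 0) ∨ ∃ k : ℕ, d = k ∧ ∃ p : MvPolynomial (Fin n) ℝ,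
      IsHomogeneousHarmonic k p ∧ ∀ x, x ≠ 0 → v x = evalAt p x := by
  have hn0 : 0 < n := by omega
  obtain ⟨x₁, -, -, h1⟩ := h.hom.exists_le_norm_rpow hn0 h.cont
  obtain ⟨x₂, -, -, h2⟩ := h.hom.neg.exists_le_norm_rpow hn0 h.cont.neg
  have hM : ∀ x ∈ Metric.closedBall (0 : EuclideanSpace ℝ (Fin n)) 1 \ {0},
      |v x| ≤ max |v x₁| |v x₂| := by
    intro x hx
    have hpow : ‖x‖ ^ d ≤ 1 :=
      Real.rpow_le_one (norm_nonneg x) (by simpa using hx.1) hd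
    have hpow0 : 0 ≤ ‖x‖ ^ d := by positivity
    have key : ∀ a : ℝ, a * ‖x‖ ^ d ≤ |a| := fun a => by
      nlinarith [le_abs_self a, abs_nonneg a, mul_le_mul_of_nonneg_right (le_abs_self a) hpow0]
    refine abs_le'.2 ⟨(h1 x hx.2).trans ((key _).trans (le_max_left _ _)),
      (h2 x hx.2).trans ((key _).trans ?_)⟩
    rw [abs_neg]
    exact le_max_right _ _
  obtain ⟨w, hw, hwv⟩ := exists_contDiff_extension hn h.cont hM h.sub h.sup
  exact homogeneous_classification hn0 h.hom (fun x hx => h.lap_eq_zero hn0 hx) hw hwv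

theorem kelvin (hn : 0 < n) (h : IsHomogeneousViscosityHarmonic d v) :
    IsHomogeneousViscosityHarmonic (2 - (n : ℝ) - d)
      fun y => ‖y‖ ^ (2 - (n : ℝ) - 2 * d) * v y := by
  have hc : ∀ x : EuclideanSpace ℝ (Fin n), x ≠ 0 →
      ContDiffAt ℝ 2 (fun y => ‖y‖ ^ (2 - (n : ℝ) - 2 * d) * v y) x := fun x hx =>
    (contDiffAt_norm_rpow _ hx).mul (h.contDiffAt_two hn hx)
  have hl : ∀ x : EuclideanSpace ℝ (Fin n), x ≠ 0 →
      lap (fun y => ‖y‖ ^ (2 - (n : ℝ) - 2 * d) * v y) x = 0 := fun x hx =>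
    lap_kelvin h.hom hx (h.contDiffAt_two hn hx) (h.lap_eq_zero hn hx)
  refine ⟨?_, fun x hx => (hc x hx).continuousAt.continuousWithinAt,
    viscositySubharmonic_of_lap_nonneg hc fun x hx => (hl x hx).ge,
    viscositySubharmonic_of_lap_nonneg (fun x hx => (hc x hx).neg) fun x hx => ?_⟩
  · convert h.hom.norm_rpow_mul (2 - (n : ℝ) - 2 * d) using 1
    ring
  · rw [lap_neg (hc x hx), hl x hx, neg_zero]

/-- The Kelvin transform has degree `2 - n - d ≥ 0`; multiplying by the inverse power of the norm
recovers `v`. -/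
theorem classification_of_le (hn : 2 ≤ n) (h : IsHomogeneousViscosityHarmonic d v)
    (hd : d ≤ -((n : ℝ) - 2)) :
    (∀ x, x ≠ 0 → v x = 0) ∨ ∃ k : ℕ, d = -((n : ℝ) - 2) - k ∧ ∃ p : MvPolynomial (Fin n) ℝ,
      IsHomogeneousHarmonic k p ∧
        ∀ x, x ≠ 0 → v x = ‖x‖ ^ (2 * d + (n : ℝ) - 2) * evalAt p x := by
  have hinv : ∀ x : EuclideanSpace ℝ (Fin n), x ≠ 0 →
      v x = ‖x‖ ^ (2 * d + (n : ℝ) - 2) * (‖x‖ ^ (2 - (n : ℝ) - 2 * d) * v x) := by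
    intro x hx
    rw [← mul_assoc, ← Real.rpow_add (norm_pos_iff.2 hx),
      show 2 * d + (n : ℝ) - 2 + (2 - (n : ℝ) - 2 * d) = 0 by ring, Real.rpow_zero, one_mul]
  rcases (h.kelvin (by omega)).classification_of_nonneg hn (by linarith)
    with h0 | ⟨k, hk, p, hp, he⟩
  · left
    intro x hx
    rw [hinv x hx, h0 x hx, mul_zero]
  · right
    refine ⟨k, by linarith, p, hp, fun x hx => ?_⟩
    rw [hinv x hx, he x hx]

/-- On a half-line `v` is a multiple of `|y|^d`, whose second derivative carries the factor
`d(d-1)`. Removability of a bounded singularity fails on the line, so this case is separate. -/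
theorem eq_zero_of_dim_one (h : IsHomogeneousViscosityHarmonic d v) (hn : n = 1)
    (hd : ¬ ∃ m : ℤ, d = m) : ∀ x, x ≠ 0 → v x = 0 := by
  subst hn
  intro x hx
  have hx0 : x 0 ≠ 0 := fun h0 => hx (PiLp.ext fun i => by rw [Subsingleton.elim i 0, h0]; rfl)
  have hpos : 0 < ‖x‖ := norm_pos_iff.2 hx
  have hev : v =ᶠ[𝓝 x] fun y => (v x * ‖x‖ ^ (-d)) * ‖y‖ ^ d := by
    have hc : ContinuousAt (fun y : EuclideanSpace ℝ (Fin 1) => y 0 / x 0) x := by fun_prop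
    filter_upwards [hc.eventually (lt_mem_nhds (by simp [hx0] : (0 : ℝ) < x 0 / x 0))] with y hy
    have hyx : y = (y 0 / x 0) • x := PiLp.ext fun i => by
      rw [Subsingleton.elim i 0]
      simp [hx0]
    set t := y 0 / x 0
    rw [hyx, h.hom t hy x hx, norm_smul, Real.norm_of_nonneg hy.le,
      Real.mul_rpow hy.le hpos.le, Real.rpow_neg hpos.le]
    have := (Real.rpow_pos_of_pos hpos d).ne'
    field_simp
  have hl := h.lap_eq_zero one_pos hx
  rw [lap_congr hev, lap_const_mul _ (contDiffAt_norm_rpow d hx), lap_norm_rpow d hx] at hl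
  have h1 : ‖x‖ ^ (-d) ≠ 0 := (Real.rpow_pos_of_pos hpos _).ne'
  have h2 : ‖x‖ ^ d / ‖x‖ ^ 2 ≠ 0 := by positivity
  have h3 : d ≠ 0 := fun h0 => hd ⟨0, by simpa using h0⟩
  have h4 : d + 1 - 2 ≠ 0 := fun h0 => hd ⟨1, by push_cast; linarith⟩
  simpa [h1, h2, h3, h4] using hl

theorem eq_zero_of_exceptional (hn : 1 ≤ n) (h : IsHomogeneousViscosityHarmonic d v)
    (hd : (-((n : ℝ) - 2) < d ∧ d < 0) ∨ ¬ ∃ m : ℤ, d = m) : ∀ x, x ≠ 0 → v x = 0 := by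
  by_cases hrange : -((n : ℝ) - 2) < d ∧ d < 0
  · exact h.eq_zero_of_neg hn (mul_neg_of_neg_of_pos hrange.2 (by linarith [hrange.1]))
  have hint : ¬ ∃ m : ℤ, d = m := hd.resolve_left hrange
  rcases hn.eq_or_lt with rfl | hn2
  · exact h.eq_zero_of_dim_one rfl hint
  rcases le_or_gt 0 d with h0 | h0
  · refine (h.classification_of_nonneg hn2 h0).resolve_right ?_
    rintro ⟨k, hk, -⟩
    exact hint ⟨k, by simpa using hk⟩
  · refine (h.classification_of_le hn2 (by by_contra hlt; exact hrange ⟨not_le.1 hlt, h0⟩)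
      ).resolve_right ?_
    rintro ⟨k, hk, -⟩
    exact hint ⟨-((n : ℤ) - 2) - k, by rw [hk]; push_cast; ring⟩

theorem exists_polynomial (hn : 2 ≤ n) {k : ℕ} (h : IsHomogeneousViscosityHarmonic d v)
    (hd : d = k) : ∃ p : MvPolynomial (Fin n) ℝ, IsHomogeneousHarmonic k p ∧
      ∀ x, x ≠ 0 → v x = evalAt p x := by
  rcases h.classification_of_nonneg hn (by rw [hd]; positivity) with h0 | ⟨j, hj, p, hp, he⟩
  · exact ⟨0, ⟨MvPolynomial.isHomogeneous_zero _ _ _, by simp⟩, fun x hx => by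
      rw [h0 x hx]; simp [evalAt]⟩
  · obtain rfl : k = j := by exact_mod_cast hd.symm.trans hj
    exact ⟨p, hp, he⟩

theorem exists_kelvin_polynomial (hn : 2 ≤ n) {k : ℕ} (h : IsHomogeneousViscosityHarmonic d v)
    (hd : d = -((n : ℝ) - 2) - k) : ∃ p : MvPolynomial (Fin n) ℝ, IsHomogeneousHarmonic k p ∧
      ∀ x, x ≠ 0 → v x = ‖x‖ ^ (2 * d + (n : ℝ) - 2) * evalAt p x := by
  have hk : (0 : ℝ) ≤ k := by positivity
  rcases h.classification_of_le hn (by linarith) with h0 | ⟨j, hj, p, hp, he⟩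
  · exact ⟨0, ⟨MvPolynomial.isHomogeneous_zero _ _ _, by simp⟩, fun x hx => by
      rw [h0 x hx]; simp [evalAt]⟩
  · obtain rfl : k = j := by
      have : (k : ℝ) = j := by linarith
      exact_mod_cast this
    exact ⟨p, hp, he⟩

/-- Entire homogeneous solutions. -/
theorem classification_of_entire (hn : 0 < n) (h : IsHomogeneousViscosityHarmonic d v)
    (hc : Continuous v) (hsub : ViscositySubharmonic univ v)
    (hsup : ViscositySubharmonic univ fun x => -v x) :
    (∀ x, v x = 0) ∨ ∃ k : ℕ, d = k ∧ ∃ p : MvPolynomial (Fin n) ℝ,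
      IsHomogeneousHarmonic k p ∧ ∀ x, v x = evalAt p x := by
  have : NeZero n := ⟨hn.ne'⟩
  have hext : ∀ g : EuclideanSpace ℝ (Fin n) → ℝ, Continuous g → (∀ x, x ≠ 0 → v x = g x) →
      ∀ x, v x = g x := fun g hg he =>
    congrFun (Continuous.ext_on (dense_compl_singleton (0 : EuclideanSpace ℝ (Fin n))) hc hg he)
  have hv : ContDiff ℝ ∞ v := contDiff_iff_contDiffAt.2 fun x =>
    contDiffAt_of_viscosity_harmonic hn isOpen_univ hc.continuousOn hsub hsup (mem_univ x)
  rcases homogeneous_classification hn h.hom (fun x hx => h.lap_eq_zero hn hx) hv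
    (Eventually.of_forall fun _ _ => rfl) with h0 | ⟨k, hk, p, hp, he⟩
  · exact Or.inl (hext _ continuous_const h0)
  · exact Or.inr ⟨k, hk, p, hp, hext _ (continuous_evalAt p) he⟩

end IsHomogeneousViscosityHarmonic

/-! ### Linearization by scaling -/

theorem symMatrix_eq_sum {n : ℕ} (H : SymMatrix n) :
    H = ∑ i, ∑ j, (H : Matrix (Fin n) (Fin n) ℝ) i j • symUnit i j := by
  have hH : (H : Matrix (Fin n) (Fin n) ℝ)ᵀ = H := H.2
  have h1 := Matrix.matrix_eq_sum_single (H : Matrix (Fin n) (Fin n) ℝ)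
  have h2 := congrArg Matrix.transpose h1
  rw [hH] at h2
  apply Subtype.ext
  -- The expansion in symmetrized units is the average of the expansions of `H` and of its
  -- transpose.
  have h3 : ((∑ i, ∑ j, (H : Matrix (Fin n) (Fin n) ℝ) i j • symUnit i j : SymMatrix n) :
      Matrix (Fin n) (Fin n) ℝ) = (1 / 2 : ℝ) • ((H : Matrix (Fin n) (Fin n) ℝ) + H) := by
    conv_rhs =>
      congr
      · skip
      · congr
        · rw [h1]
        · rw [h2]
    simp only [Matrix.transpose_sum, Matrix.transpose_single, AddSubmonoidClass.coe_finsetSum,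
      Submodule.coe_smul, symUnit, ← Finset.sum_add_distrib, Finset.smul_sum, smul_add,
      Matrix.smul_single, smul_eq_mul, mul_one]
    simp only [mul_comm]
  rw [h3, ← two_smul ℝ, smul_smul]
  norm_num

theorem fderiv_eq_sum_gradMatrix {n : ℕ} (F : SymMatrix n → ℝ) (M H : SymMatrix n) :
    fderiv ℝ F M H = ∑ i, ∑ j, gradMatrix F M i j * (H : Matrix (Fin n) (Fin n) ℝ) i j := by
  conv_lhs => rw [symMatrix_eq_sum H]
  simp only [map_sum, map_smul, smul_eq_mul, gradMatrix, Matrix.of_apply, mul_comm]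

theorem fderiv_nonneg_of_ray {n : ℕ} {F : SymMatrix n → ℝ} (hF : DifferentiableAt ℝ F 0)
    (hF0 : F 0 = 0) {H : SymMatrix n} (h : ∀ s : ℝ, 0 < s → 0 ≤ F (s • H)) :
    0 ≤ fderiv ℝ F 0 H := by
  have hl : HasDerivAt (fun s : ℝ => s • H) H 0 := by
    have := (hasDerivAt_id (0 : ℝ)).smul_const H
    rw [one_smul] at this
    exact this
  have hF' : HasFDerivAt F (fderiv ℝ F 0) ((0 : ℝ) • H) := by simpa using hF.hasFDerivAt
  have hd : HasDerivAt (fun s : ℝ => F (s • H)) (fderiv ℝ F 0 H) 0 := hF'.comp_hasDerivAt 0 hl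
  have ht := hd.tendsto_slope_zero_right
  refine ge_of_tendsto ht ?_
  filter_upwards [self_mem_nhdsWithin] with s hs
  have hs' : (0 : ℝ) < s := hs
  simpa [hF0] using mul_nonneg (inv_pos.2 hs').le (h s hs')

/-- A homogeneous subsolution is a subsolution along the whole ray of each Hessian. -/
theorem IsViscositySubsolution.ray_nonneg {n : ℕ} {F : SymMatrix n → ℝ}
    {Ω : Set (EuclideanSpace ℝ (Fin n))} (hΩ : IsOpen Ω)
    (hΩs : ∀ t : ℝ, 0 < t → ∀ x ∈ Ω, t • x ∈ Ω) {u : EuclideanSpace ℝ (Fin n) → ℝ} {d : ℝ}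
    (hd : d ≠ 2) (hhom : ∀ t : ℝ, 0 < t → ∀ x ∈ Ω, u (t • x) = t ^ d * u x)
    (hsub : IsViscositySubsolution F Ω u) {x₀ : EuclideanSpace ℝ (Fin n)} (hx₀ : x₀ ∈ Ω)
    {φ : EuclideanSpace ℝ (Fin n) → ℝ} (hφ : ContDiffAt ℝ 2 φ x₀) (he : φ x₀ = u x₀)
    (hle : ∀ᶠ x in 𝓝 x₀, u x ≤ φ x) {s : ℝ} (hs : 0 < s) :
    0 ≤ F (s • symHessian φ x₀ hφ) := by
  have hd2 : d - 2 ≠ 0 := sub_ne_zero.2 hd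
  -- Chosen so that `t^(d-2) = s`; this is where `d ≠ 2` enters.
  set t : ℝ := s ^ (1 / (d - 2)) with ht
  have htpos : 0 < t := Real.rpow_pos_of_pos hs _
  have hts : t ^ d * (t⁻¹ * t⁻¹) = s := by
    have h1 : t⁻¹ * t⁻¹ = t ^ (-2 : ℝ) := by
      rw [Real.rpow_neg htpos.le, Real.rpow_two]; ring
    rw [h1, ← Real.rpow_add htpos, ht, ← Real.rpow_mul hs.le,
      show 1 / (d - 2) * (d + -2) = 1 by field_simp; ring, Real.rpow_one]
  let B : EuclideanSpace ℝ (Fin n) →L[ℝ] EuclideanSpace ℝ (Fin n) :=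
    t⁻¹ • ContinuousLinearMap.id ℝ _
  have hB : ∀ x, B x = t⁻¹ • x := fun x => rfl
  have hBx : B (t • x₀) = x₀ := by rw [hB, inv_smul_smul₀ htpos.ne']
  have hφB : ContDiffAt ℝ 2 φ (B (t • x₀)) := by rwa [hBx]
  have hφB' : ContDiffAt ℝ 2 (fun x => φ (B x)) (t • x₀) :=
    hφB.comp (t • x₀) B.contDiff.contDiffAt
  have hψ : ContDiffAt ℝ 2 (fun x => t ^ d * φ (B x)) (t • x₀) := contDiffAt_const.mul hφB'
  have hBt : Tendsto B (𝓝 (t • x₀)) (𝓝 x₀) := by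
    have := B.continuous.tendsto (t • x₀)
    rwa [hBx] at this
  -- By homogeneity, `t^d φ(x/t)` touches `u` from above at `t • x₀`.
  have h := hsub (t • x₀) (hΩs t htpos x₀ hx₀) _ hψ (by
    simp only [hBx]
    rw [he, hhom t htpos x₀ hx₀]) (by
    filter_upwards [hBt.eventually hle, hBt.eventually (hΩ.mem_nhds hx₀)] with x h1 h2
    have h3 := hhom t htpos (B x) h2
    rw [hB, smul_inv_smul₀ htpos.ne', ← hB] at h3
    rw [h3]
    exact mul_le_mul_of_nonneg_left h1 (by positivity))
  convert h using 2
  refine Subtype.ext ?_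
  change s • hessian φ x₀ = hessian (fun x => t ^ d * φ (B x)) (t • x₀)
  rw [hessian_const_mul _ hφB']
  ext i j
  rw [Matrix.smul_apply, Matrix.smul_apply, hessian_comp_linear B hφB, hBx]
  simp only [smul_eq_mul, hB, map_smul, smul_apply, hessian, Matrix.of_apply]
  rw [← hts]
  ring

/-- The reflection `M ↦ -F(-M)` lets every supersolution statement be deduced from the subsolution
one. -/
theorem IsViscositySupersolution.neg {n : ℕ} {F : SymMatrix n → ℝ}
    {Ω : Set (EuclideanSpace ℝ (Fin n))} {u : EuclideanSpace ℝ (Fin n) → ℝ}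
    (h : IsViscositySupersolution F Ω u) :
    IsViscositySubsolution (fun M => -F (-M)) Ω fun x => -u x := by
  intro x₀ hx₀ φ hφ he hle
  have h1 := h x₀ hx₀ (fun x => -φ x) hφ.neg (by rw [he, neg_neg])
    (hle.mono fun x hx => by linarith)
  have h2 : symHessian (fun x => -φ x) x₀ hφ.neg = -symHessian φ x₀ hφ := by
    refine Subtype.ext ?_
    change hessian (fun x => -φ x) x₀ = -hessian φ x₀
    simpa using hessian_const_mul (-1) hφ
  rw [h2] at h1
  simpa using h1

/-- Subsolutions of `∑ G_ij D_ij u = 0` in the viscosity sense. -/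
def LinearSubsolution {n : ℕ} (G : Matrix (Fin n) (Fin n) ℝ)
    (Ω : Set (EuclideanSpace ℝ (Fin n))) (u : EuclideanSpace ℝ (Fin n) → ℝ) : Prop :=
  ∀ x₀ ∈ Ω, ∀ φ : EuclideanSpace ℝ (Fin n) → ℝ, ContDiffAt ℝ 2 φ x₀ →
    φ x₀ = u x₀ → (∀ᶠ x in 𝓝 x₀, u x ≤ φ x) → 0 ≤ ∑ i, ∑ j, G i j * hessian φ x₀ i j

theorem IsViscositySubsolution.linear {n : ℕ} {F : SymMatrix n → ℝ}
    (hF : DifferentiableAt ℝ F 0) (hF0 : F 0 = 0)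
    {Ω : Set (EuclideanSpace ℝ (Fin n))} (hΩ : IsOpen Ω)
    (hΩs : ∀ t : ℝ, 0 < t → ∀ x ∈ Ω, t • x ∈ Ω) {u : EuclideanSpace ℝ (Fin n) → ℝ} {d : ℝ}
    (hd : d ≠ 2) (hhom : ∀ t : ℝ, 0 < t → ∀ x ∈ Ω, u (t • x) = t ^ d * u x)
    (hsub : IsViscositySubsolution F Ω u) : LinearSubsolution (gradMatrix F 0) Ω u := by
  intro x₀ hx₀ φ hφ he hle
  have := fderiv_nonneg_of_ray hF hF0 fun s hs => hsub.ray_nonneg hΩ hΩs hd hhom hx₀ hφ he hle hs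
  rwa [fderiv_eq_sum_gradMatrix] at this

/-- The ray inequality for the radial test function needs no value of `F` at zero; letting `s → 0`
and using continuity gives one. -/
theorem apply_zero_nonneg {n : ℕ} (hn : 0 < n) {F : SymMatrix n → ℝ} (hF : Continuous F)
    {u : EuclideanSpace ℝ (Fin n) → ℝ} {d : ℝ} (hd : d ≠ 2) (hhom : HomogeneousOfDegree d u)
    (hu : ContinuousOn u {0}ᶜ) (hsub : IsViscositySubsolution F {0}ᶜ u) : 0 ≤ F 0 := by
  obtain ⟨x₀, hx₀, he, hle⟩ := hhom.exists_le_norm_rpow hn hu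
  have hφ : ContDiffAt ℝ 2 (fun x => u x₀ * ‖x‖ ^ d) x₀ :=
    contDiffAt_const.mul (contDiffAt_norm_rpow d hx₀)
  have hray := fun s hs => hsub.ray_nonneg (s := s) isOpen_ne
    (fun t ht x hx => smul_ne_zero ht.ne' hx) hd hhom hx₀ hφ he
    ((eventually_ne_nhds hx₀).mono hle) hs
  have hlim : Tendsto (fun s : ℝ => F (s • symHessian _ x₀ hφ)) (𝓝[>] 0) (𝓝 (F 0)) := by
    have : Continuous fun s : ℝ => F (s • symHessian _ x₀ hφ) := by fun_prop
    simpa using this.continuousWithinAt.tendsto (s := Ioi 0) (x := 0)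
  refine ge_of_tendsto hlim ?_
  filter_upwards [self_mem_nhdsWithin] with s hs
  exact hray s hs

theorem IsViscositySolution.linear {n : ℕ} {F : SymMatrix n → ℝ}
    (hF : Differentiable ℝ F) (hF0 : F 0 = 0)
    {Ω : Set (EuclideanSpace ℝ (Fin n))} (hΩ : IsOpen Ω)
    (hΩs : ∀ t : ℝ, 0 < t → ∀ x ∈ Ω, t • x ∈ Ω) {u : EuclideanSpace ℝ (Fin n) → ℝ} {d : ℝ}
    (hd : d ≠ 2) (hhom : ∀ t : ℝ, 0 < t → ∀ x ∈ Ω, u (t • x) = t ^ d * u x)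
    (h : IsViscositySolution F Ω u) : LinearSubsolution (gradMatrix F 0) Ω u ∧
      LinearSubsolution (gradMatrix F 0) Ω fun x => -u x := by
  refine ⟨h.2.1.linear (hF 0) hF0 hΩ hΩs hd hhom, ?_⟩
  intro x₀ hx₀ φ hφ he hle
  have hray := fun s hs => h.2.2.neg.ray_nonneg (s := s) hΩ hΩs hd
    (fun t ht x hx => by rw [hhom t ht x hx]; ring) hx₀ hφ he hle hs
  -- The reflected operator on the ray of `H` is `-F` on the ray of `-H`; the two signs cancel in
  -- the derivative and leave `DF(0)[H] ≥ 0`.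
  have := fderiv_nonneg_of_ray (F := fun M => -F M) (H := -symHessian φ x₀ hφ) (hF 0).fun_neg
    (by simp [hF0]) fun s hs => by simpa using hray s hs
  have e : fderiv ℝ (fun M => -F M) 0 = -fderiv ℝ F 0 := (hF 0).hasFDerivAt.fun_neg.fderiv
  rw [e, neg_apply, map_neg, neg_neg, fderiv_eq_sum_gradMatrix] at this
  exact this

theorem apply_zero_eq_zero {n : ℕ} (hn : 0 < n) {F : SymMatrix n → ℝ} (hF : Continuous F)
    {u : EuclideanSpace ℝ (Fin n) → ℝ} {d : ℝ} (hd : d ≠ 2) (hhom : HomogeneousOfDegree d u)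
    (h : IsViscositySolution F {0}ᶜ u) : F 0 = 0 := by
  have h1 := apply_zero_nonneg hn hF hd hhom h.1 h.2.1
  have h2 := apply_zero_nonneg (F := fun M => -F (-M)) hn (by fun_prop) hd hhom.neg h.1.neg
    h.2.2.neg
  simp only [neg_zero] at h2
  linarith

/-- Homogeneity extends to the origin by continuity. -/
theorem HomogeneousOfDegree.smul_of_continuous {n : ℕ} (hn : 0 < n) {d : ℝ}
    {u : EuclideanSpace ℝ (Fin n) → ℝ} (hhom : HomogeneousOfDegree d u) (hu : Continuous u)
    {t : ℝ} (ht : 0 < t) (x : EuclideanSpace ℝ (Fin n)) : u (t • x) = t ^ d * u x := by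
  have : NeZero n := ⟨hn.ne'⟩
  exact congrFun (Continuous.ext_on (dense_compl_singleton (0 : EuclideanSpace ℝ (Fin n)))
    (by fun_prop : Continuous fun x => u (t • x)) (by fun_prop) fun x hx => hhom t ht x hx) x

/-! ### Linear change of variables -/

/-- The lower ellipticity bound makes `G` positive definite. A factorization `G = Bᵀ B` then exists,
and `det G > 0` makes the factor invertible. -/
theorem exists_mul_transpose_eq {n : ℕ} {μ : ℝ} (hμ : 0 < μ) {G : Matrix (Fin n) (Fin n) ℝ}
    (hG : (G - μ • (1 : Matrix (Fin n) (Fin n) ℝ)).PosSemidef) :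
    ∃ A : Matrix (Fin n) (Fin n) ℝ, IsUnit A.det ∧ A * Aᵀ = G := by
  have h1 : G.PosDef := by
    have := (Matrix.PosDef.smul (Matrix.PosDef.one : (1 : Matrix (Fin n) (Fin n) ℝ).PosDef) hμ
      ).posSemidef_add hG
    simpa using this
  obtain ⟨B, hB⟩ : ∃ B : Matrix (Fin n) (Fin n) ℝ, G = star B * B := by
    open scoped MatrixOrder in
    exact CStarAlgebra.nonneg_iff_eq_star_mul_self.mp h1.posSemidef.nonneg
  have hB' : Bᵀ * Bᵀᵀ = G := by
    rw [hB, Matrix.star_eq_conjTranspose, Matrix.conjTranspose_eq_transpose_of_trivial,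
      Matrix.transpose_transpose]
  refine ⟨Bᵀ, ?_, hB'⟩
  have hdet := h1.det_pos
  rw [← hB', Matrix.det_mul, Matrix.det_transpose] at hdet
  rw [Matrix.det_transpose, isUnit_iff_ne_zero]
  rintro h0
  simp [h0] at hdet

/-- Test functions are carried over by `φ ↦ φ ∘ A⁻¹`. The coefficient matrix becomes `A⁻¹ G A⁻ᵀ =
1`, so the linear operator turns into the Laplacian. -/
theorem LinearSubsolution.comp_linear {n : ℕ} {G A : Matrix (Fin n) (Fin n) ℝ}
    (hA : IsUnit A.det) (hAG : A * Aᵀ = G) {Ω : Set (EuclideanSpace ℝ (Fin n))}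
    {u : EuclideanSpace ℝ (Fin n) → ℝ} (h : LinearSubsolution G Ω u) :
    ViscositySubharmonic {y | Matrix.toEuclideanLin A y ∈ Ω}
      fun y => u (Matrix.toEuclideanLin A y) := by
  intro y hy φ hφ he hle
  let B : EuclideanSpace ℝ (Fin n) →L[ℝ] EuclideanSpace ℝ (Fin n) :=
    LinearMap.toContinuousLinearMap (Matrix.toEuclideanLin A⁻¹)
  have hBA : ∀ z, B (Matrix.toEuclideanLin A z) = z := fun z => by
    change Matrix.toEuclideanLin A⁻¹ (Matrix.toEuclideanLin A z) = z
    simp [Matrix.toLpLin_apply, Matrix.mulVec_mulVec, Matrix.nonsing_inv_mul A hA]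
  have hAB : ∀ z, Matrix.toEuclideanLin A (B z) = z := fun z => by
    change Matrix.toEuclideanLin A (Matrix.toEuclideanLin A⁻¹ z) = z
    simp [Matrix.toLpLin_apply, Matrix.mulVec_mulVec, Matrix.mul_nonsing_inv A hA]
  have hBe : ∀ i k, B (EuclideanSpace.single i 1) k = A⁻¹ k i := fun i k => by
    change Matrix.toEuclideanLin A⁻¹ (EuclideanSpace.single i 1) k = A⁻¹ k i
    simp [Matrix.toLpLin_apply]
  set x := Matrix.toEuclideanLin A y with hx
  have hBx : B x = y := hBA y
  have hφB : ContDiffAt ℝ 2 φ (B x) := by rwa [hBx]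
  have hBt : Tendsto B (𝓝 x) (𝓝 y) := by
    have := B.continuous.tendsto x
    rwa [hBx] at this
  have key := h x hy (fun z => φ (B z)) (hφB.comp x B.contDiff.contDiffAt)
    (by rw [hBx, he]) ((hBt.eventually hle).mono fun z hz => by simpa only [hAB] using hz)
  have hsum : ∑ i, ∑ j, G i j * hessian (fun z => φ (B z)) x i j =
      ∑ k, ∑ l, (A⁻¹ * G * A⁻¹ᵀ) k l * hessian φ y k l := by
    have e : ∀ i j, G i j * hessian (fun z => φ (B z)) x i j =
        ∑ k, ∑ l, A⁻¹ k i * G i j * A⁻¹ l j * hessian φ y k l := fun i j => by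
      rw [hessian_comp_linear B hφB, fderiv_fderiv_apply_eq_sum, hBx, Finset.mul_sum]
      refine Finset.sum_congr rfl fun k _ => ?_
      rw [Finset.mul_sum]
      refine Finset.sum_congr rfl fun l _ => ?_
      rw [hBe, hBe]
      ring
    have e' : ∀ k l, (A⁻¹ * G * A⁻¹ᵀ) k l * hessian φ y k l =
        ∑ i, ∑ j, A⁻¹ k i * G i j * A⁻¹ l j * hessian φ y k l := fun k l => by
      simp only [Matrix.mul_apply, Finset.sum_mul, Matrix.transpose_apply]
      exact Finset.sum_comm
    simp_rw [e, e']
    calc _ = ∑ i, ∑ k, ∑ j, ∑ l, A⁻¹ k i * G i j * A⁻¹ l j * hessian φ y k l :=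
          Finset.sum_congr rfl fun i _ => Finset.sum_comm
      _ = ∑ k, ∑ i, ∑ j, ∑ l, A⁻¹ k i * G i j * A⁻¹ l j * hessian φ y k l := Finset.sum_comm
      _ = ∑ k, ∑ i, ∑ l, ∑ j, A⁻¹ k i * G i j * A⁻¹ l j * hessian φ y k l :=
          Finset.sum_congr rfl fun k _ => Finset.sum_congr rfl fun i _ => Finset.sum_comm
      _ = _ := Finset.sum_congr rfl fun k _ => Finset.sum_comm
  have hone : A⁻¹ * G * A⁻¹ᵀ = 1 := by
    rw [← hAG, ← Matrix.mul_assoc, Matrix.nonsing_inv_mul A hA, Matrix.one_mul,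
      ← Matrix.transpose_mul, Matrix.nonsing_inv_mul A hA, Matrix.transpose_one]
  rw [hsum, hone] at key
  simpa [lap, Matrix.one_apply] using key

theorem toEuclideanLin_ne_zero {n : ℕ} {A : Matrix (Fin n) (Fin n) ℝ} (hA : IsUnit A.det)
    {y : EuclideanSpace ℝ (Fin n)} (hy : y ≠ 0) : Matrix.toEuclideanLin A y ≠ 0 := by
  intro h0
  have : Matrix.toEuclideanLin A⁻¹ (Matrix.toEuclideanLin A y) = y := by
    simp [Matrix.toLpLin_apply, Matrix.mulVec_mulVec, Matrix.nonsing_inv_mul A hA]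
  rw [h0, map_zero] at this
  exact hy this.symm

theorem toEuclideanLin_apply_inv {n : ℕ} {A : Matrix (Fin n) (Fin n) ℝ} (hA : IsUnit A.det)
    (x : EuclideanSpace ℝ (Fin n)) :
    Matrix.toEuclideanLin A (Matrix.toEuclideanLin A⁻¹ x) = x := by
  simp [Matrix.toLpLin_apply, Matrix.mulVec_mulVec, Matrix.mul_nonsing_inv A hA]

end FullyNonlinear

end

/-! ### The main theorem. -/

theorem mainTheorem1 (n : ℕ) (hn : 1 ≤ n) (μ : ℝ) (hμ : 0 < μ)
    (F : FullyNonlinear.SymMatrix n → ℝ) (hF : ContDiff ℝ 1 F)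
    (hell : FullyNonlinear.UniformlyElliptic μ F)
    (d : ℝ) (hd : d ≠ 2) (u : EuclideanSpace ℝ (Fin n) → ℝ)
    (hhom : FullyNonlinear.HomogeneousOfDegree d u)
    (hsol : FullyNonlinear.IsViscositySolution F {0}ᶜ u) :
    -- `u` is a classical solution of the constant coefficient linear equation
    ContDiffOn ℝ ∞ u {0}ᶜ ∧
    (∀ x : EuclideanSpace ℝ (Fin n), x ≠ 0 →
      ∑ i, ∑ j, FullyNonlinear.gradMatrix F 0 i j * FullyNonlinear.hessian u x i j = 0) ∧
    -- `u` vanishes in the exceptional range of degrees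
    (((-((n : ℝ) - 2) < d ∧ d < 0) ∨ ¬ ∃ m : ℤ, d = m) →
      ∀ x : EuclideanSpace ℝ (Fin n), x ≠ 0 → u x = 0) ∧
    -- the new coordinates `x = A y`
    ∃ A : Matrix (Fin n) (Fin n) ℝ, IsUnit A.det ∧ A * Aᵀ = FullyNonlinear.gradMatrix F 0 ∧
      InnerProductSpace.HarmonicOnNhd (fun y => u (Matrix.toEuclideanLin A y)) {0}ᶜ ∧
      -- integer degrees `d = k ≥ 0`
      (2 ≤ n → ∀ k : ℕ, d = k →
        ∃ p : MvPolynomial (Fin n) ℝ, FullyNonlinear.IsHomogeneousHarmonic k p ∧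
          ∀ y : EuclideanSpace ℝ (Fin n), y ≠ 0 →
            u (Matrix.toEuclideanLin A y) = FullyNonlinear.evalAt p y) ∧
      -- integer degrees `d = -(n - 2) - k ≤ -(n - 2)`: Kelvin transforms
      (2 ≤ n → ∀ k : ℕ, d = -((n : ℝ) - 2) - k →
        ∃ p : MvPolynomial (Fin n) ℝ, FullyNonlinear.IsHomogeneousHarmonic k p ∧
          ∀ y : EuclideanSpace ℝ (Fin n), y ≠ 0 →
            u (Matrix.toEuclideanLin A y) =
              ‖y‖ ^ (2 * d + (n : ℝ) - 2) * FullyNonlinear.evalAt p y) ∧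
      -- solutions in all of `ℝⁿ`
      (FullyNonlinear.IsViscositySolution F Set.univ u →
        (∀ x, u x = 0) ∨
        ∃ k : ℕ, d = k ∧ ∃ p : MvPolynomial (Fin n) ℝ,
          FullyNonlinear.IsHomogeneousHarmonic k p ∧
          ∀ y : EuclideanSpace ℝ (Fin n),
            u (Matrix.toEuclideanLin A y) = FullyNonlinear.evalAt p y) := by

  have hn0 : 0 < n := hn
  have hFd : Differentiable ℝ F := hF.differentiable (by norm_num)
  have hF0 : F 0 = 0 :=
    FullyNonlinear.apply_zero_eq_zero hn0 hFd.continuous hd hhom hsol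
  obtain ⟨A, hA, hAG⟩ := FullyNonlinear.exists_mul_transpose_eq hμ (hell 0).1
  have hlin := hsol.linear hFd hF0 isOpen_ne (fun t ht x hx => smul_ne_zero ht.ne' hx) hd hhom
  have hAc : Continuous (Matrix.toEuclideanLin A) := LinearMap.continuous_of_finiteDimensional _
  have hv : FullyNonlinear.IsHomogeneousViscosityHarmonic d
      fun y => u (Matrix.toEuclideanLin A y) := by
    refine ⟨fun t ht x hx => ?_, ?_, ?_, ?_⟩
    · simp only [map_smul]
      exact hhom t ht _ (FullyNonlinear.toEuclideanLin_ne_zero hA hx)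
    · exact hsol.1.comp hAc.continuousOn fun x hx => FullyNonlinear.toEuclideanLin_ne_zero hA hx
    · exact (hlin.1.comp_linear hA hAG).mono fun x hx =>
        FullyNonlinear.toEuclideanLin_ne_zero hA hx
    · exact (hlin.2.comp_linear hA hAG).mono fun x hx =>
        FullyNonlinear.toEuclideanLin_ne_zero hA hx
  have hsmooth : ∀ x : EuclideanSpace ℝ (Fin n), x ≠ 0 → ContDiffAt ℝ ∞ u x := by
    intro x hx
    have hA' : IsUnit A⁻¹.det := by
      rw [Matrix.det_nonsing_inv]
      exact hA.ringInverse
    have h1 := hv.contDiffAt hn0 (FullyNonlinear.toEuclideanLin_ne_zero hA' hx)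
    have h2 : ContDiff ℝ ∞ (Matrix.toEuclideanLin A⁻¹) :=
      (LinearMap.toContinuousLinearMap (Matrix.toEuclideanLin A⁻¹)).contDiff
    have h3 := h1.comp x h2.contDiffAt
    simpa only [Function.comp_def, FullyNonlinear.toEuclideanLin_apply_inv hA] using h3
  have hsmooth2 : ∀ x : EuclideanSpace ℝ (Fin n), x ≠ 0 → ContDiffAt ℝ 2 u x := fun x hx =>
    (hsmooth x hx).of_le (WithTop.coe_le_coe.2 (le_top : (2 : ℕ∞) ≤ ⊤))
  refine ⟨fun x hx => (hsmooth x hx).contDiffWithinAt, fun x hx => ?_, fun hex x hx => ?_,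
    A, hA, hAG, fun y hy => ⟨hv.contDiffAt_two hn0 hy, ?_⟩,
    fun hn2 k hk => hv.exists_polynomial hn2 hk,
    fun hn2 k hk => hv.exists_kelvin_polynomial hn2 hk, fun hent => ?_⟩
  -- Being smooth, `u` is its own test function, and so is `-u`; the two inequalities give equality.
  · have h1 := hlin.1 x hx u (hsmooth2 x hx) rfl (Eventually.of_forall fun _ => le_rfl)
    have h2 := hlin.2 x hx (fun y => -u y) (hsmooth2 x hx).neg rfl
      (Eventually.of_forall fun _ => le_rfl)
    have h3 : FullyNonlinear.hessian (fun y => -u y) x = -FullyNonlinear.hessian u x := by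
      simpa using FullyNonlinear.hessian_const_mul (-1) (hsmooth2 x hx)
    simp only [h3, Matrix.neg_apply, mul_neg, Finset.sum_neg_distrib] at h2
    linarith
  · have := hv.eq_zero_of_exceptional hn hex (Matrix.toEuclideanLin A⁻¹ x) (fun h0 => hx ?_)
    · simpa only [FullyNonlinear.toEuclideanLin_apply_inv hA] using this
    · rw [← FullyNonlinear.toEuclideanLin_apply_inv hA x, h0, map_zero]
  · filter_upwards [isOpen_ne.mem_nhds hy] with z hz
    rw [FullyNonlinear.laplacian_eq_lap, hv.lap_eq_zero hn0 hz]
    rfl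
  -- The linearization is repeated on the whole space, where test functions may also touch at the
  -- origin; homogeneity there follows by continuity.
  · have huc : Continuous u := continuousOn_univ.1 hent.1
    have hlin' := hent.linear hFd hF0 isOpen_univ (fun t _ x _ => mem_univ (t • x)) hd
      fun t ht x _ => hhom.smul_of_continuous hn0 huc ht x
    rcases hv.classification_of_entire hn0 (huc.comp hAc) (hlin'.1.comp_linear hA hAG)
      (hlin'.2.comp_linear hA hAG) with h0 | h
    · left
      intro x
      have := h0 (Matrix.toEuclideanLin A⁻¹ x)
      simpa only [FullyNonlinear.toEuclideanLin_apply_inv hA] using this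
    · exact Or.inr h
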